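/- Let $\mathbb K=\mathbb R$ or $\mathbb C$, let $X_1,\dots,X_8$ be the standard basis of $\mathbb K^8$ and $\alpha_1,\dots,\alpha_8$ the dual basis. Let $2Nilp_8(\mathbb K)$ be the affine variety of Lie brackets $\mu$ on $\mathbb K^8$ with $\mu(\mu(x,y),z)=0$ for all $x,y,z$ (given by their structure constants, the zero bracket included), with its Zariski topology and the action $(g\cdot\mu)(x,y)=g\,\mu(g^{-1}x,g^{-1}y)$ of $GL_8(\mathbb K)$; the orbit $\mathcal O(\mu)$ is the set of brackets isomorphic to $\mu$, and $\overline{S}$ denotes the Zariski closure of $S$ in $2Nilp_8(\mathbb K)$. The characteristic sequence of a nilpotent Lie algebra $\mathfrak g\neq 0$ is the lexicographic maximum, over $X\in\mathfrak g\setminus[\mathfrak g,\mathfrak g]$, of the decreasing sequence of sizes of the Jordan blocks of $\mathrm{ad}\,X$. Let $\mathcal F^{8,2}_{2,4}\subset 2Nilp_8(\mathbb K)$ be the set of brackets with characteristic sequence $(2,2,1,1,1,1)$. Let $\mathcal C_1(\mathcal F^{8,2}_{2,4})$ be the set of all brackets on $\mathbb K^8$ that are isomorphic to a bracket of the form $\mu_0+\varphi$,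 where $\mu_0$ is the skew-symmetric bracket whose only nonzero products of basis vectors are $[X_1,X_2]=X_3$, $[X_1,X_4]=X_5$ (and those deduced by skew-symmetry), and $\varphi$ is skew-symmetric with $\varphi(X_i,X_j)=a_{ij}^3X_3+a_{ij}^5X_5$ for $i,j\in\{2,4,6,7,8\}$ (arbitrary $a_{ij}^k\in\mathbb K$) and $\varphi(X_i,\cdot)=0$ for $i\in\{1,3,5\}$. Finally let $\mathfrak k_8$ be the Lie algebra on $\mathbb K^8$ with Maurer-Cartan equations (where $d\alpha(x,y)=-\alpha([x,y])$) $$d\alpha_3=\alpha_1\wedge\alpha_2+\alpha_4\wedge\alpha_6+\alpha_7\wedge\alpha_8,\qquad d\alpha_5=\alpha_1\wedge\alpha_4+\alpha_2\wedge\alpha_8+\alpha_6\wedge\alpha_7,\qquad d\alpha_i=0\ (i\ne 3,5).$$ 1. For $\mathbb K=\mathbb R$ and for $\mathbb K=\mathbb C$, the component $\mathcal C_1(\mathcal F^{8,2}_{2,4})$ is the Zariski closure of the orbit of $\mathfrak k_8$: within the family one has $\mathcal C_1(\mathcal F^{8,2}_{2,4})=\mathcal F^{8,2}_{2,4}\cap\overline{\mathcal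 O(\mathfrak k_8)}$, and in $2Nilp_8(\mathbb K)$ one has $\overline{\mathcal C_1(\mathcal F^{8,2}_{2,4})}=\overline{\mathcal O(\mathfrak k_8)}$. 2. For $\mathbb K=\mathbb C$, every Lie algebra of $\overline{\mathcal C_1(\mathcal F^{8,2}_{2,4})}$ (in particular every Lie algebra of $\mathcal C_1(\mathcal F^{8,2}_{2,4})$) that is not isomorphic to $\mathfrak k_8$ is a contraction of $\mathfrak k_8$: for its bracket $\mu$ there is a continuous map $f:\,]0,1]\to GL_8(\mathbb C)$ such that $\lim_{\varepsilon\to0^+}f(\varepsilon)\bigl([f(\varepsilon)^{-1}x,f(\varepsilon)^{-1}y]_{\mathfrak k_8}\bigr)=\mu(x,y)$ for all $x,y\in\mathbb C^8$. -/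

import Mathlib

open Filter Topology

noncomputable section

namespace TwoNilp

/-- Bilinear multiplications on `𝕜ⁿ`; `Pi.single i 1` is the basis vector `X_{i+1}`. -/
abbrev Bracket (𝕜 : Type*) [Field 𝕜] (n : ℕ) :=
  (Fin n → 𝕜) →ₗ[𝕜] (Fin n → 𝕜) →ₗ[𝕜] (Fin n → 𝕜)

section General

variable {𝕜 : Type*} [Field 𝕜] {n : ℕ}

/-- `μ` is a Lie bracket on `𝕜ⁿ`: alternating, with the Jacobi identity. -/
def IsLieBracket (μ : Bracket 𝕜 n) : Prop :=
  (∀ x, μ x x = 0) ∧ ∀ x y z, μ (μ x y) z + μ (μ y z) x + μ (μ z x) y = 0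

variable (𝕜 n) in
/-- The variety `2Nilp_n` of Lie brackets on `𝕜ⁿ` with `[[x, y], z] = 0`. As a (closed) variety
it contains the abelian bracket. -/
def twoNilp : Set (Bracket 𝕜 n) :=
  {μ | IsLieBracket μ ∧ ∀ x y z, μ (μ x y) z = 0}

/-- The derived algebra `C¹ = [𝕜ⁿ, 𝕜ⁿ]` of a bracket. -/
def derived (μ : Bracket 𝕜 n) : Submodule 𝕜 (Fin n → 𝕜) :=
  Submodule.span 𝕜 {z | ∃ x y, μ x y = z}

/-- `l` is the decreasing list of the sizes of the Jordan blocks of the nilpotent endomorphism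
`T`: there is a basis `b (i, j)`, `j < l[i]`, with `T b (i, 0) = 0` and
`T b (i, j + 1) = b (i, j)`. -/
def IsNilpotentJordanType {V : Type*} [AddCommGroup V] [Module 𝕜 V] (T : V →ₗ[𝕜] V)
    (l : List ℕ) : Prop :=
  l.Pairwise (· ≥ ·) ∧ (∀ k ∈ l, 0 < k) ∧
    ∃ b : Module.Basis (Σ i : Fin l.length, Fin (l.get i)) 𝕜 V,
      ∀ (i : Fin l.length) (j : Fin (l.get i)),
        (j.val = 0 → T (b ⟨i, j⟩) = 0) ∧
        ∀ j' : Fin (l.get i), j'.val = j.val + 1 → T (b ⟨i, j'⟩) = b ⟨i, j⟩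

/-- `l` is the characteristic sequence of `μ`: the maximum, for the lexicographic order, of the
Jordan types of `ad X`, where `X` runs through the complement of the derived algebra. -/
def HasCharacteristicSequence (μ : Bracket 𝕜 n) (l : List ℕ) : Prop :=
  (∃ X, X ∉ derived μ ∧ IsNilpotentJordanType (μ X) l) ∧
    ∀ X, X ∉ derived μ → ∀ l', IsNilpotentJordanType (μ X) l' → l' ≤ l

/-- The action of `GL_n` on brackets: `(g • μ) (x, y) = g (μ (g⁻¹ x, g⁻¹ y))`. -/
def transport (g : GL (Fin n) 𝕜) (μ : Bracket 𝕜 n) : Bracket 𝕜 n :=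
  (μ.compl₁₂ (Matrix.toLin' (g⁻¹ : GL (Fin n) 𝕜).val)
    (Matrix.toLin' (g⁻¹ : GL (Fin n) 𝕜).val)).compr₂ (Matrix.toLin' g.val)

/-- The orbit of `μ`, that is, the set of all brackets isomorphic to `μ`. -/
def orbit (μ : Bracket 𝕜 n) : Set (Bracket 𝕜 n) :=
  {ν | ∃ g : GL (Fin n) 𝕜, ν = transport g μ}

/-- The structure constants of `μ`: `μ (X_i, X_j) = ∑ₖ C (i, j, k) X_k`. -/
def structureConstants (μ : Bracket 𝕜 n) : Fin n × Fin n × Fin n → 𝕜 :=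
  fun t => μ (Pi.single t.1 1) (Pi.single t.2.1 1) t.2.2

/-- The closure of `S` in `2Nilp_n` for the Zariski topology: the elements of `2Nilp_n` whose
structure constants are zeros of all polynomials that vanish on `S`. -/
def zariskiClosure (S : Set (Bracket 𝕜 n)) : Set (Bracket 𝕜 n) :=
  {μ | μ ∈ twoNilp 𝕜 n ∧
    structureConstants μ ∈
      MvPolynomial.zeroLocus 𝕜 (MvPolynomial.vanishingIdeal 𝕜 (structureConstants '' S))}

/-- The form `α_{i+1} ∧ α_{j+1}`, where the `α`s are the dual basis of the `X`s. -/
def wedge (i j : Fin n) : (Fin n → 𝕜) →ₗ[𝕜] (Fin n → 𝕜) →ₗ[𝕜] 𝕜 :=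
  LinearMap.mk₂ 𝕜 (fun x y => x i * y j - x j * y i)
    (fun x x' y => by simp only [Pi.add_apply]; ring)
    (fun c x y => by simp only [Pi.smul_apply, smul_eq_mul]; ring)
    (fun x y y' => by simp only [Pi.add_apply]; ring)
    (fun c x y => by simp only [Pi.smul_apply, smul_eq_mul]; ring)

/-- The multiplication `(x, y) ↦ ω (x, y) X_{k+1}`. -/
def along (ω : (Fin n → 𝕜) →ₗ[𝕜] (Fin n → 𝕜) →ₗ[𝕜] 𝕜) (k : Fin n) : Bracket 𝕜 n :=
  ω.compr₂ (LinearMap.toSpanSingleton 𝕜 (Fin n → 𝕜) (Pi.single k 1))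

end General

section Dimension8

variable (𝕜 : Type*) [Field 𝕜]

/-- The family `F^{8,2}_{2,4}` of `8`-dimensional `2`-step nilpotent Lie algebras of
characteristic sequence `(2,2,1,1,1,1)`. -/
def F24 : Set (Bracket 𝕜 8) :=
  {μ | μ ∈ twoNilp 𝕜 8 ∧ HasCharacteristicSequence μ [2, 2, 1, 1, 1, 1]}

/-- The Lie algebra `g_{2,4}`: `[X₁, X₂] = X₃`, `[X₁, X₄] = X₅`. -/
def g24 : Bracket 𝕜 8 := along (wedge 0 1) 2 + along (wedge 0 3) 4

/-- The cocycles that give the first component: skew-symmetric `φ` with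
`φ (X_i, X_j) = a_{ij}³ X₃ + a_{ij}⁵ X₅` for `i, j ∈ {2, 4, 6, 7, 8}` and `φ (X_i, ·) = 0` for
`i ∈ {1, 3, 5}`. -/
def cocyclesC1 : Set (Bracket 𝕜 8) :=
  {φ | (∀ x, φ x x = 0) ∧
    (∀ y, φ (Pi.single 0 1) y = 0 ∧ φ (Pi.single 2 1) y = 0 ∧ φ (Pi.single 4 1) y = 0) ∧
    ∀ x y, φ x y ∈ Submodule.span 𝕜 {(Pi.single 2 1 : Fin 8 → 𝕜), Pi.single 4 1}}

/-- The first component `C₁(F^{8,2}_{2,4})`: all brackets isomorphic to some `g_{2,4} + φ`, with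
`φ` as above. -/
def C1 : Set (Bracket 𝕜 8) :=
  {μ | ∃ φ ∈ cocyclesC1 𝕜, μ ∈ orbit (g24 𝕜 + φ)}

/-- The Lie algebra `k₈`. With `dα (x, y) = -α [x, y]`, its Maurer-Cartan equations are
`dα₃ = α₁∧α₂ + α₄∧α₆ + α₇∧α₈`, `dα₅ = α₁∧α₄ + α₂∧α₈ + α₆∧α₇`, and `dα_i = 0` otherwise. -/
def k8 : Bracket 𝕜 8 :=
  -along (wedge 0 1 + wedge 3 5 + wedge 6 7) 2 - along (wedge 0 3 + wedge 1 7 + wedge 5 6) 4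

end Dimension8

/-- `μ₀` is a contraction of `μ`: there is a continuous `f : ]0, 1] → GL_n` such that
`f(ε) [f(ε)⁻¹ x, f(ε)⁻¹ y] → μ₀ (x, y)` as `ε → 0`, for all `x, y`. -/
def IsContraction {𝕜 : Type*} [RCLike 𝕜] {n : ℕ} (μ₀ μ : Bracket 𝕜 n) : Prop :=
  ∃ f : ℝ → GL (Fin n) 𝕜, ContinuousOn f (Set.Ioc 0 1) ∧
    ∀ x y, Tendsto (fun ε => transport (f ε) μ x y) (𝓝[>] 0) (𝓝 (μ₀ x y))

end TwoNilp

end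

/-!
A bracket of `2Nilp₈` whose derived algebra has dimension at most two is given by a pair of
alternating forms on a space of dimension at least six, and in a suitable basis the pair becomes
anti-triangular. Adding a multiple of the pair of `k₈`, itself anti-diagonal up to isomorphism,
keeps it anti-triangular. An anti-triangular pair can be brought to the diagonal form of `k₈` by
elimination as soon as a certain discriminant is invertible, over any commutative ring. Over an
algebraically closed field this puts almost every point of the line from `μ` to `k₈` in the orbit
of `k₈`; over the ring of continuous functions on `]0, 1]` it yields the contraction. For a general
field, the polynomial equations of the orbit do not see the extension to the algebraic closure.
Hence the closure of the orbit is the locus `dim [μ, μ] ≤ 2`, and `C₁` consists of the brackets of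
this locus for which some `ad x` has rank two.
-/

noncomputable section

namespace TwoNilp

open scoped Matrix

section Transport

variable {𝕜 : Type*} [Field 𝕜] {n : ℕ} {μ ν κ : Bracket 𝕜 n} {g : GL (Fin n) 𝕜}

theorem transport_apply (g : GL (Fin n) 𝕜) (μ : Bracket 𝕜 n) (x y : Fin n → 𝕜) :
    transport g μ x y = g.val *ᵥ μ (g⁻¹.val *ᵥ x) (g⁻¹.val *ᵥ y) := by
  simp [transport]

theorem GL_inv_mulVec_mulVec (g : GL (Fin n) 𝕜) (x : Fin n → 𝕜) :
    g⁻¹.val *ᵥ (g.val *ᵥ x) = x := by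
  rw [Matrix.mulVec_mulVec, Units.inv_mul, Matrix.one_mulVec]

theorem GL_mulVec_inv_mulVec (g : GL (Fin n) 𝕜) (x : Fin n → 𝕜) :
    g.val *ᵥ (g⁻¹.val *ᵥ x) = x := by
  rw [Matrix.mulVec_mulVec, Units.mul_inv, Matrix.one_mulVec]

theorem transport_mul (g h : GL (Fin n) 𝕜) (μ : Bracket 𝕜 n) :
    transport (g * h) μ = transport g (transport h μ) :=
  LinearMap.ext₂ fun x y => by
    simp only [transport_apply, mul_inv_rev, Units.val_mul, Matrix.mulVec_mulVec]

theorem transport_one (μ : Bracket 𝕜 n) : transport 1 μ = μ :=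
  LinearMap.ext₂ fun x y => by simp [transport_apply]

theorem transport_add_smul (g : GL (Fin n) 𝕜) (μ ν : Bracket 𝕜 n) (s : 𝕜) :
    transport g (μ + s • ν) = transport g μ + s • transport g ν :=
  LinearMap.ext₂ fun x y => by
    simp [transport_apply, Matrix.mulVec_add, Matrix.mulVec_smul]

theorem eq_transport_iff :
    ν = transport g μ ↔ ∀ x y, ν (g.val *ᵥ x) (g.val *ᵥ y) = g.val *ᵥ μ x y := by
  refine ⟨?_, fun h => LinearMap.ext₂ fun x y => ?_⟩
  · rintro rfl x y
    simp only [transport_apply, GL_inv_mulVec_mulVec]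
  · simp only [transport_apply, ← h, GL_mulVec_inv_mulVec]

theorem mem_orbit_symm (h : μ ∈ orbit ν) : ν ∈ orbit μ := by
  obtain ⟨g, rfl⟩ := h
  exact ⟨g⁻¹, by rw [← transport_mul, inv_mul_cancel, transport_one]⟩

theorem mem_orbit_trans (h : μ ∈ orbit ν) (h' : ν ∈ orbit κ) : μ ∈ orbit κ := by
  obtain ⟨g, rfl⟩ := h
  obtain ⟨g', rfl⟩ := h'
  exact ⟨g * g', by rw [transport_mul]⟩

end Transport

section TwoStep

variable {𝕜 : Type*} [Field 𝕜] {n : ℕ} {μ : Bracket 𝕜 n}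

/- The Jacobi identity is a consequence of two-step nilpotency. -/
theorem mem_twoNilp : μ ∈ twoNilp 𝕜 n ↔ μ.IsAlt ∧ ∀ x y z, μ (μ x y) z = 0 :=
  ⟨fun h => ⟨h.1.1, h.2⟩, fun h => ⟨⟨h.1, by simp [h.2]⟩, h.2⟩⟩

theorem apply_mem_derived (μ : Bracket 𝕜 n) (x y : Fin n → 𝕜) : μ x y ∈ derived μ :=
  Submodule.subset_span ⟨x, y, rfl⟩

theorem derived_le {p : Submodule 𝕜 (Fin n → 𝕜)} (h : ∀ x y, μ x y ∈ p) : derived μ ≤ p :=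
  Submodule.span_le.2 (by rintro _ ⟨x, y, rfl⟩; exact h x y)

theorem finrank_derived_le_two {v w : Fin n → 𝕜}
    (h : ∀ x y, μ x y ∈ Submodule.span 𝕜 {v, w}) : Module.finrank 𝕜 (derived μ) ≤ 2 := by
  classical
  have hle := derived_le h
  rw [← Finset.coe_pair] at hle
  exact (Submodule.finrank_mono hle).trans
    ((finrank_span_finset_le_card _).trans Finset.card_le_two)

theorem derived_le_ker (h : μ ∈ twoNilp 𝕜 n) : derived μ ≤ LinearMap.ker μ :=
  derived_le fun x y => LinearMap.mem_ker.2 (LinearMap.ext (h.2 x y))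

theorem transport_mem_twoNilp (g : GL (Fin n) 𝕜) (h : μ ∈ twoNilp 𝕜 n) :
    transport g μ ∈ twoNilp 𝕜 n := by
  rw [mem_twoNilp] at h ⊢
  refine ⟨fun x => ?_, fun x y z => ?_⟩
  · rw [transport_apply, h.1, Matrix.mulVec_zero]
  · simp only [transport_apply, GL_inv_mulVec_mulVec, h.2, Matrix.mulVec_zero]

theorem finrank_derived_transport_le (g : GL (Fin n) 𝕜) (μ : Bracket 𝕜 n) :
    Module.finrank 𝕜 (derived (transport g μ)) ≤ Module.finrank 𝕜 (derived μ) := by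
  have hle : derived (transport g μ) ≤ (derived μ).map (Matrix.toLin' g.val) :=
    derived_le fun x y => by
      rw [transport_apply, ← Matrix.toLin'_apply]
      exact Submodule.mem_map_of_mem (apply_mem_derived μ _ _)
  exact (Submodule.finrank_mono hle).trans (Submodule.finrank_map_le _ _)

@[simp] theorem wedge_apply (i j : Fin n) (x y : Fin n → 𝕜) :
    wedge i j x y = x i * y j - x j * y i := rfl

@[simp] theorem along_apply (ω : (Fin n → 𝕜) →ₗ[𝕜] (Fin n → 𝕜) →ₗ[𝕜] 𝕜) (k : Fin n)
    (x y : Fin n → 𝕜) : along ω k x y = ω x y • Pi.single k 1 := rfl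

end TwoStep

section Constants

variable {R S : Type*} [CommRing R] [CommRing S] {n : ℕ}

/-- The bilinear multiplication on `Rⁿ` with structure constants `c`, for a commutative ring of
coefficients: the polynomial and continuous families of brackets below are multiplications over
rings of polynomials and of continuous functions. -/
def ofConstants (c : Fin n × Fin n × Fin n → R) :
    (Fin n → R) →ₗ[R] (Fin n → R) →ₗ[R] (Fin n → R) :=
  LinearMap.mk₂ R (fun x y k => ∑ i, ∑ j, x i * y j * c (i, j, k))
    (fun x x' y => by ext k; simp [add_mul, Finset.sum_add_distrib])
    (fun a x y => by ext k; simp [Finset.mul_sum, mul_assoc])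
    (fun x y y' => by ext k; simp [mul_add, add_mul, Finset.sum_add_distrib])
    (fun a x y => by ext k; simp [Finset.mul_sum, mul_assoc, mul_left_comm])

theorem ofConstants_apply (c : Fin n × Fin n × Fin n → R) (x y : Fin n → R) (k : Fin n) :
    ofConstants c x y k = ∑ i, ∑ j, x i * y j * c (i, j, k) := rfl

@[simp] theorem ofConstants_single (c : Fin n × Fin n × Fin n → R) (i j : Fin n) :
    ofConstants c (Pi.single i 1) (Pi.single j 1) = fun k => c (i, j, k) := by
  ext k
  simp [ofConstants_apply, Pi.single_apply]

theorem map_ofConstants (φ : R →+* S) (c : Fin n × Fin n × Fin n → R) (x y : Fin n → R) :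
    φ ∘ ofConstants c x y = ofConstants (φ ∘ c) (φ ∘ x) (φ ∘ y) := by
  ext k
  simp [ofConstants_apply]

theorem ext_single {B B' : (Fin n → R) →ₗ[R] (Fin n → R) →ₗ[R] (Fin n → R)}
    (h : ∀ i j, B (Pi.single i 1) (Pi.single j 1) = B' (Pi.single i 1) (Pi.single j 1)) :
    B = B' :=
  LinearMap.ext_basis (Pi.basisFun R (Fin n)) (Pi.basisFun R (Fin n)) (by simpa using h)

theorem map_apply_of_single {B B' : (Fin n → R) →ₗ[R] (Fin n → R) →ₗ[R] (Fin n → R)}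
    {P : Matrix (Fin n) (Fin n) R}
    (h : ∀ i j, B (P *ᵥ Pi.single i 1) (P *ᵥ Pi.single j 1) =
      P *ᵥ B' (Pi.single i 1) (Pi.single j 1)) (x y : Fin n → R) :
    B (P *ᵥ x) (P *ᵥ y) = P *ᵥ B' x y := by
  have : B.compl₁₂ (Matrix.toLin' P) (Matrix.toLin' P) = B'.compr₂ (Matrix.toLin' P) :=
    ext_single (by simpa using h)
  simpa using LinearMap.congr_fun₂ this x y

theorem ofConstants_add_smul (c d : Fin n × Fin n × Fin n → R) (a : R) :
    ofConstants (c + a • d) = ofConstants c + a • ofConstants d :=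
  ext_single fun i j => by ext k; simp

@[simp] theorem ofConstants_structureConstants {𝕜 : Type*} [Field 𝕜] (μ : Bracket 𝕜 n) :
    ofConstants (structureConstants μ) = μ :=
  ext_single fun i j => by rw [ofConstants_single]; rfl

@[simp] theorem structureConstants_ofConstants {𝕜 : Type*} [Field 𝕜]
    (c : Fin n × Fin n × Fin n → 𝕜) : structureConstants (ofConstants c) = c := by
  ext ⟨i, j, k⟩
  simp [structureConstants]

theorem exists_GL_of_span_eq_top {b : Fin n → Fin n → R}
    (hb : Submodule.span R (Set.range b) = ⊤) :
    ∃ g : GL (Fin n) R, ∀ i, g.val *ᵥ Pi.single i 1 = b i := by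
  have hsurj : Function.Surjective (Matrix.of b)ᵀ.mulVec := fun v => by
    have hv : v ∈ Submodule.span R (Set.range b) := hb ▸ Submodule.mem_top
    obtain ⟨c, hc⟩ := (Submodule.mem_span_range_iff_exists_fun R).1 hv
    refine ⟨c, hc ▸ ?_⟩
    ext j
    simp [Matrix.mulVec, dotProduct, mul_comm]
  refine ⟨(Matrix.mulVec_surjective_iff_isUnit.1 hsurj).unit, fun i => ?_⟩
  ext j
  simp

end Constants

section Elimination

open Submodule

variable {A V W Z : Type*} [CommRing A] [AddCommGroup V] [AddCommGroup W] [AddCommGroup Z]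
  [Module A V] [Module A W] [Module A Z]

theorem span_range_sup_le_of_sub_mem {ι : Type*} {f g : ι → V} {p : Submodule A V}
    (h : ∀ i, f i - g i ∈ p) : span A (Set.range f) ⊔ p ≤ span A (Set.range g) ⊔ p := by
  refine sup_le (span_le.2 ?_) le_sup_right
  rintro _ ⟨i, rfl⟩
  rw [← add_sub_cancel (g i) (f i)]
  exact add_mem_sup (subset_span ⟨i, rfl⟩) (h i)

theorem span_range_sup_eq_of_sub_mem {ι : Type*} {f g : ι → V} {p : Submodule A V}
    (h : ∀ i, f i - g i ∈ p) : span A (Set.range f) ⊔ p = span A (Set.range g) ⊔ p :=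
  le_antisymm (span_range_sup_le_of_sub_mem h)
    (span_range_sup_le_of_sub_mem fun i => by simpa using neg_mem (h i))

theorem span_range_cons {n : ℕ} (v : V) (e : Fin n → V) :
    span A (Set.range (Fin.cons v e : Fin (n + 1) → V)) = span A {v} ⊔ span A (Set.range e) := by
  rw [Fin.range_cons, span_insert]

theorem exists_diagonal (B : V →ₗ[A] W →ₗ[A] Z) {n : ℕ} {p : Fin n → Z}
    (hp : ∀ i j, i ≠ j → ∀ v w, B v w ∈ span A {p i, p j}) (e : Fin n → V) (f : Fin n → W)
    (hdiag : ∀ i, B (e i) (f i) = p i) (htri : ∀ i j, i < j → B (e i) (f j) = 0) :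
    ∃ (e' : Fin n → V) (f' : Fin n → W), span A (Set.range e') = span A (Set.range e) ∧
      span A (Set.range f') = span A (Set.range f) ∧
      ∀ i j, B (e' i) (f' j) = if i = j then p i else 0 := by
  induction n with
  | zero => exact ⟨e, f, rfl, rfl, fun i => i.elim0⟩
  | succ n ih =>
    obtain ⟨v, e, rfl⟩ : ∃ v e₀, e = Fin.cons v e₀ := ⟨_, _, (Fin.cons_self_tail e).symm⟩
    obtain ⟨w, f, rfl⟩ : ∃ w f₀, f = Fin.cons w f₀ := ⟨_, _, (Fin.cons_self_tail f).symm⟩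
    simp only [Fin.forall_fin_succ, Fin.cons_zero, Fin.cons_succ] at hdiag htri
    obtain ⟨e', f', he', hf', hB⟩ := ih (p := fun i => p i.succ)
      (fun i j hij => hp _ _ (by simpa using hij)) e f hdiag.2
      (fun i j hij => (htri.2 i).2 j (by simpa using hij))
    have hv : ∀ j, B v (f' j) = 0 := fun j => by
      have hle : span A (Set.range f) ≤ LinearMap.ker (B v) := span_le.2 <| by
        rintro _ ⟨i, rfl⟩
        exact htri.1.2 i (Fin.succ_pos i)
      exact hle (hf' ▸ subset_span ⟨j, rfl⟩)
    choose x y hxy using fun i : Fin n =>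
      mem_span_pair.1 (hp i.succ 0 (Fin.succ_ne_zero i) (e' i) w)
    refine ⟨Fin.cons v fun i => e' i - y i • v, Fin.cons (w - ∑ j, x j • f' j) f', ?_, ?_, ?_⟩
    · rw [span_range_cons, span_range_cons, ← he', sup_comm, sup_comm (span A {v})]
      exact span_range_sup_eq_of_sub_mem fun i => by
        simpa using smul_mem _ (y i) (mem_span_singleton_self v)
    · rw [span_range_cons, span_range_cons, ← hf', ← Set.range_const (ι := Unit),
        ← Set.range_const (ι := Unit) (c := w)]
      refine span_range_sup_eq_of_sub_mem fun _ => ?_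
      simpa using sum_mem fun j _ => smul_mem _ (x j) (subset_span (Set.mem_range_self j))
    · simp [Fin.forall_fin_succ, hv, hdiag.1, hB, (Fin.succ_ne_zero _).symm, ← hxy]

theorem exists_isotropic {B : V →ₗ[A] V →ₗ[A] Z} (hB : B.IsAlt) {n : ℕ} {p : Fin n → Z}
    (hp : ∀ i j, i ≠ j → ∀ v w, B v w ∈ span A {p i, p j}) {e : Fin n → V} (f : Fin n → V)
    (he : ∀ i j, B (e i) (e j) = 0) (hef : ∀ i j, B (e i) (f j) = if i = j then p i else 0) :
    ∃ f' : Fin n → V,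
      span A (Set.range f') ⊔ span A (Set.range e) = span A (Set.range f) ⊔ span A (Set.range e) ∧
      (∀ i j, B (e i) (f' j) = if i = j then p i else 0) ∧ ∀ i j, B (f' i) (f' j) = 0 := by
  obtain ⟨c, hc⟩ : ∃ c : Fin n → Fin n → A, ∀ i j, i < j →
      B (f i) (f j) = c j i • p i - c i j • p j := by
    choose! x y hxy using fun i j (h : i < j) => mem_span_pair.1 (hp i j h.ne (f i) (f j))
    refine ⟨fun i j => if i < j then -y i j else x j i, fun i j h => ?_⟩
    simp [h, h.not_gt, hxy i j h]
  have hfe : ∀ i j, B (f i) (e j) = if i = j then -p i else 0 := fun i j => by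
    rw [← hB.neg, hef]
    aesop
  have hlt : ∀ i j, i < j → B (f i + ∑ k, c i k • e k) (f j + ∑ k, c j k • e k) = 0 :=
    fun i j h => by simp [hc i j h, hfe, hef, he, sub_add_eq_add_sub]
  refine ⟨fun i => f i + ∑ k, c i k • e k, span_range_sup_eq_of_sub_mem fun i => ?_,
    fun i j => by simp [hef, he], fun i j => ?_⟩
  · simpa using sum_mem fun k _ => smul_mem _ (c i k) (subset_span (Set.mem_range_self k))
  · obtain h | rfl | h := lt_trichotomy i j
    · exact hlt i j h
    · exact hB _
    · exact hB.eq_iff.1 (hlt j i h)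

end Elimination

section Diagonal

variable {A A' : Type*} [CommRing A] [CommRing A'] {n : ℕ}

theorem ofConstants_add (c d : Fin n × Fin n × Fin n → A) :
    ofConstants (c + d) = ofConstants c + ofConstants d := by
  simpa using ofConstants_add_smul c d 1

variable (A) in
/-- The structure constants of the multiplication with only nonzero products
`[X_{i+1}, X_{j+1}] = X_{k+1} = -[X_{j+1}, X_{i+1}]`, for `i ≠ j`. -/
def wedgeConstants (i j k : Fin n) : Fin n × Fin n × Fin n → A :=
  Pi.single (i, j, k) 1 - Pi.single (j, i, k) 1

theorem ofConstants_wedgeConstants (i j k : Fin n) (x y : Fin n → A) :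
    ofConstants (wedgeConstants A i j k) x y = Pi.single k (x i * y j - x j * y i) := by
  ext l
  obtain rfl | h := eq_or_ne l k
  · simp [ofConstants_apply, wedgeConstants, Pi.single_apply, mul_sub, ite_and]
  · simp [ofConstants_apply, wedgeConstants, h]

theorem map_comp_wedgeConstants (φ : A →+* A') (i j k : Fin n) :
    φ ∘ wedgeConstants A i j k = wedgeConstants A' i j k := by
  ext t
  simp [wedgeConstants, Pi.single_apply, apply_ite φ]

variable (A) in
/-- The structure constants of the diagonal algebra `[X₁, X₆] = X₇`, `[X₂, X₅] = X₈`,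
`[X₃, X₄] = X₇ + X₈`, the normal form of `k₈` over an algebraically closed field. -/
def diagonalConstants : Fin 8 × Fin 8 × Fin 8 → A :=
  wedgeConstants A 0 5 6 + wedgeConstants A 1 4 7 + wedgeConstants A 2 3 6 + wedgeConstants A 2 3 7

theorem map_comp_diagonalConstants (φ : A →+* A') :
    φ ∘ diagonalConstants A = diagonalConstants A' := by
  simp only [diagonalConstants, ← map_comp_wedgeConstants φ]
  ext t
  simp

theorem ofConstants_diagonalConstants (x y : Fin 8 → A) :
    ofConstants (diagonalConstants A) x y =
      Pi.single 6 (x 0 * y 5 - x 5 * y 0 + (x 2 * y 3 - x 3 * y 2)) +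
        Pi.single 7 (x 1 * y 4 - x 4 * y 1 + (x 2 * y 3 - x 3 * y 2)) := by
  simp only [diagonalConstants, ofConstants_add, LinearMap.add_apply, ofConstants_wedgeConstants,
    Pi.single_add]
  abel

theorem exists_equiv_diagonal {B : (Fin 8 → A) →ₗ[A] (Fin 8 → A) →ₗ[A] (Fin 8 → A)}
    (hB : B.IsAlt) {e f : Fin 3 → Fin 8 → A} {p q : Fin 8 → A} (he : ∀ i j, B (e i) (e j) = 0)
    (hf : ∀ i j, B (f i) (f j) = 0)
    (hef : ∀ i j, B (e i) (f j) = if i = j then (![p, q, p + q] : Fin 3 → Fin 8 → A) i else 0)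
    (hp : B p = 0) (hq : B q = 0)
    (hspan : Submodule.span A (Set.range e ∪ Set.range f ∪ {p, q}) = ⊤) :
    ∃ g : GL (Fin 8) A, ∀ x y, B (g.val *ᵥ x) (g.val *ᵥ y) =
      g.val *ᵥ ofConstants (diagonalConstants A) x y := by
  have hsub : Set.range e ∪ Set.range f ∪ {p, q} ⊆
      Set.range ![e 0, e 1, e 2, f 2, f 1, f 0, p, q] := by
    simp [Set.subset_def, or_imp, forall_and, Fin.forall_fin_succ]
  obtain ⟨g, hg⟩ := exists_GL_of_span_eq_top (top_le_iff.1 (hspan ▸ Submodule.span_mono hsub))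
  refine ⟨g, map_apply_of_single fun i j => ?_⟩
  have hp' : ∀ v, B v p = 0 := fun v => hB.eq_iff.1 (by simp [hp])
  have hq' : ∀ v, B v q = 0 := fun v => hB.eq_iff.1 (by simp [hq])
  have hfe : ∀ i j, B (f j) (e i) = if i = j then -(![p, q, p + q] : Fin 3 → Fin 8 → A) i else 0 :=
    fun i j => by rw [← hB.neg, hef, apply_ite Neg.neg, neg_zero]
  have hsingle : ∀ k a, g.val *ᵥ Pi.single k a = a • g.val *ᵥ Pi.single k 1 := fun k a => by
    rw [← Matrix.mulVec_smul, ← Pi.single_smul, smul_eq_mul, mul_one]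
  rw [ofConstants_diagonalConstants, Matrix.mulVec_add, hsingle 6, hsingle 7]
  simp only [hg]
  fin_cases i <;> fin_cases j <;>
    simp [he, hf, hef, hfe, hp, hq, hp', hq', add_comm]

end Diagonal

section Antitriangular

variable {A A' : Type*} [CommRing A] [CommRing A'] {n : ℕ}

theorem isAlt_ofConstants {c : Fin n × Fin n × Fin n → A} (hdiag : ∀ i k, c (i, i, k) = 0)
    (hskew : ∀ i j k, c (j, i, k) = -c (i, j, k)) : (ofConstants c).IsAlt := fun x => by
  ext k
  rw [ofConstants_apply, ← Fintype.sum_prod_type']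
  refine Finset.sum_involution (fun t _ => t.swap) (fun t _ => ?_) (fun t _ ht h => ?_)
    (fun t _ => by simp) (fun t _ => by simp)
  · rw [Prod.fst_swap, Prod.snd_swap, hskew]
    ring
  · obtain ⟨i, j⟩ := t
    obtain rfl : j = i := congrArg Prod.fst h
    simp [hdiag] at ht

/-- Structure constants on `A⁸` of a two-step nilpotent bracket with values in the central plane
spanned by `X₇, X₈`, whose matrix with respect to `X₁, …, X₆` vanishes above the antidiagonal. -/
structure IsAntitriangular (c : Fin 8 × Fin 8 × Fin 8 → A) : Prop where
  diag : ∀ i k, c (i, i, k) = 0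
  skew : ∀ i j k, c (j, i, k) = -c (i, j, k)
  plane : ∀ i j k, k ≠ 6 → k ≠ 7 → c (i, j, k) = 0
  central : ∀ i j k, 6 ≤ i → c (i, j, k) = 0
  antitriangular : ∀ i j k, i.val + j.val < 5 → c (i, j, k) = 0

theorem IsAntitriangular.map {c : Fin 8 × Fin 8 × Fin 8 → A} (h : IsAntitriangular c)
    (φ : A →+* A') : IsAntitriangular (φ ∘ c) where
  diag i k := by simp [h.diag]
  skew i j k := by simp [h.skew i j k]
  plane i j k h6 h7 := by simp [h.plane i j k h6 h7]
  central i j k hi := by simp [h.central i j k hi]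
  antitriangular i j k h5 := by simp [h.antitriangular i j k h5]

theorem IsAntitriangular.add_smul {c d : Fin 8 × Fin 8 × Fin 8 → A} (hc : IsAntitriangular c)
    (hd : IsAntitriangular d) (a : A) : IsAntitriangular (c + a • d) where
  diag i k := by simp [hc.diag, hd.diag]
  skew i j k := by simp [hc.skew i j k, hd.skew i j k, add_comm]
  plane i j k h6 h7 := by simp [hc.plane i j k h6 h7, hd.plane i j k h6 h7]
  central i j k hi := by simp [hc.central i j k hi, hd.central i j k hi]
  antitriangular i j k h5 := by
    simp [hc.antitriangular i j k h5, hd.antitriangular i j k h5]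

theorem isAntitriangular_diagonalConstants : IsAntitriangular (diagonalConstants A) := by
  have h : IsAntitriangular (diagonalConstants ℤ) := by constructor <;> decide +kernel
  simpa only [map_comp_diagonalConstants] using h.map (Int.castRingHom A)

/-- The coordinate determinant of two vectors of the plane spanned by `X₇, X₈`. -/
def planeDet (p q : Fin 8 → A) : A := p 6 * q 7 - p 7 * q 6

theorem mem_span_pair_of_isUnit_planeDet {p q v : Fin 8 → A} (hp : ∀ k, k ≠ 6 → k ≠ 7 → p k = 0)
    (hq : ∀ k, k ≠ 6 → k ≠ 7 → q k = 0) (hv : ∀ k, k ≠ 6 → k ≠ 7 → v k = 0)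
    (h : IsUnit (planeDet p q)) : v ∈ Submodule.span A {p, q} := by
  obtain ⟨d, hd⟩ := h.exists_left_inv
  refine Submodule.mem_span_pair.2 ⟨d * planeDet v q, d * planeDet p v, ?_⟩
  ext k
  simp only [planeDet, Pi.add_apply, Pi.smul_apply, smul_eq_mul] at hd ⊢
  by_cases h6 : k = 6
  · subst h6
    linear_combination v 6 * hd
  by_cases h7 : k = 7
  · subst h7
    linear_combination v 7 * hd
  simp [hp k h6 h7, hq k h6 h7, hv k h6 h7]

variable {c : Fin 8 × Fin 8 × Fin 8 → A}

theorem IsAntitriangular.isAlt (hc : IsAntitriangular c) : (ofConstants c).IsAlt :=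
  isAlt_ofConstants hc.diag hc.skew

theorem IsAntitriangular.apply_eq_zero_of_ne (hc : IsAntitriangular c) (x y : Fin 8 → A)
    {k : Fin 8} (h6 : k ≠ 6) (h7 : k ≠ 7) : ofConstants c x y k = 0 := by
  simp [ofConstants_apply, hc.plane _ _ k h6 h7]

theorem IsAntitriangular.apply_eq_zero_of_plane (hc : IsAntitriangular c) {p : Fin 8 → A}
    (hp : ∀ k, k ≠ 6 → k ≠ 7 → p k = 0) : ofConstants c p = 0 := by
  refine LinearMap.ext fun y => funext fun k => ?_
  refine (ofConstants_apply c p y k).trans <|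
    Finset.sum_eq_zero fun i _ => Finset.sum_eq_zero fun j _ => ?_
  obtain hi | hi := lt_or_ge i 6
  · rw [hp i (by omega) (by omega), zero_mul, zero_mul]
  · rw [hc.central i j k hi, mul_zero]

variable (c) in
/-- The three products `[X₁, X₆]`, `[X₂, X₅]`, `[X₃, X₄]`, which form the antidiagonal of the matrix
of an antitriangular bracket. -/
def antidiagonal (i : Fin 3) : Fin 8 → A :=
  fun k => c (![0, 1, 2] i, ![5, 4, 3] i, k)

/-- Product of the pairwise determinants of the antidiagonal products: it is invertible exactly when
any two of them span the plane of `X₇, X₈`. -/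
def discriminant (c : Fin 8 × Fin 8 × Fin 8 → A) : A :=
  planeDet (antidiagonal c 0) (antidiagonal c 1) * planeDet (antidiagonal c 2) (antidiagonal c 1) *
    planeDet (antidiagonal c 0) (antidiagonal c 2)

theorem map_discriminant (φ : A →+* A') : φ (discriminant c) = discriminant (φ ∘ c) := by
  simp [discriminant, planeDet, antidiagonal]

theorem planeDet_swap (p q : Fin 8 → A) : planeDet q p = -planeDet p q := by
  simp only [planeDet]
  ring

theorem isUnit_planeDet_antidiagonal (h : IsUnit (discriminant c)) {i j : Fin 3} (hij : i ≠ j) :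
    IsUnit (planeDet (antidiagonal c i) (antidiagonal c j)) := by
  simp only [discriminant, IsUnit.mul_iff] at h
  obtain ⟨⟨h01, h21⟩, h02⟩ := h
  have h10 := planeDet_swap (antidiagonal c 0) (antidiagonal c 1) ▸ h01.neg
  have h12 := planeDet_swap (antidiagonal c 2) (antidiagonal c 1) ▸ h21.neg
  have h20 := planeDet_swap (antidiagonal c 0) (antidiagonal c 2) ▸ h02.neg
  fin_cases i <;> fin_cases j <;> first | exact absurd rfl hij | assumption

theorem IsAntitriangular.antidiagonal_eq_zero (hc : IsAntitriangular c) (i : Fin 3) (k : Fin 8)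
    (h6 : k ≠ 6) (h7 : k ≠ 7) : antidiagonal c i k = 0 :=
  hc.plane _ _ k h6 h7

theorem IsAntitriangular.exists_diagonal (hc : IsAntitriangular c) (hd : IsUnit (discriminant c)) :
    ∃ e f : Fin 3 → Fin 8 → A,
      (∀ i j, ofConstants c (e i) (e j) = 0) ∧ (∀ i j, ofConstants c (f i) (f j) = 0) ∧
      (∀ i j, ofConstants c (e i) (f j) = if i = j then antidiagonal c i else 0) ∧
      ∀ k : Fin 8, k < 6 →
        Pi.single k 1 ∈ Submodule.span A (Set.range f) ⊔ Submodule.span A (Set.range e) := by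
  let e : Fin 3 → Fin 8 → A := fun i => Pi.single (![0, 1, 2] i) 1
  let f : Fin 3 → Fin 8 → A := fun i => Pi.single (![5, 4, 3] i) 1
  have hp : ∀ i j, i ≠ j → ∀ v w,
      ofConstants c v w ∈ Submodule.span A {antidiagonal c i, antidiagonal c j} :=
    fun i j hij v w => mem_span_pair_of_isUnit_planeDet (hc.antidiagonal_eq_zero i)
      (hc.antidiagonal_eq_zero j) (fun k h6 h7 => hc.apply_eq_zero_of_ne v w h6 h7)
      (isUnit_planeDet_antidiagonal hd hij)
  obtain ⟨e', f', he', hf', hef⟩ := TwoNilp.exists_diagonal (ofConstants c) hp e f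
    (fun i => ofConstants_single _ _ _)
    (fun i j hij => (ofConstants_single _ _ _).trans <| funext fun k =>
      hc.antitriangular _ _ k (by revert hij; decide +revert))
  have hee : ∀ i j, ofConstants c (e' i) (e' j) = 0 := fun i j => by
    refine (Submodule.mem_bot A).1 (LinearMap.BilinMap.apply_apply_mem_of_mem_span ⊥ (Set.range e)
      (Set.range e) _ ?_ _ _ (he' ▸ Submodule.subset_span ⟨i, rfl⟩)
      (he' ▸ Submodule.subset_span ⟨j, rfl⟩))
    rintro _ ⟨i, rfl⟩ _ ⟨j, rfl⟩
    exact (Submodule.mem_bot A).2 <| (ofConstants_single _ _ _).trans <| funext fun k =>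
      hc.antitriangular _ _ k (by decide +revert)
  obtain ⟨f'', hspan, hef'', hff⟩ := exists_isotropic hc.isAlt hp f' hee hef
  refine ⟨e', f'', hee, hff, hef'', fun k hk => ?_⟩
  rw [hspan, he', hf', ← Submodule.span_union]
  refine Submodule.subset_span ?_
  obtain ⟨i, rfl⟩ | ⟨i, rfl⟩ : (∃ i : Fin 3, ![5, 4, 3] i = k) ∨ ∃ i : Fin 3, ![0, 1, 2] i = k := by
    decide +revert
  exacts [Or.inl ⟨i, rfl⟩, Or.inr ⟨i, rfl⟩]

theorem eq_top_of_single_mem {p : Submodule A (Fin n → A)} (h : ∀ i, Pi.single i 1 ∈ p) : p = ⊤ :=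
  top_le_iff.1 <| (Pi.basisFun A (Fin n)).span_eq ▸ Submodule.span_le.2 (by
    rintro _ ⟨i, rfl⟩
    simpa using h i)

theorem IsAntitriangular.exists_isUnit_smul_add_smul_antidiagonal (hc : IsAntitriangular c)
    (hd : IsUnit (discriminant c)) : ∃ x y : A, IsUnit x ∧ IsUnit y ∧
      x • antidiagonal c 0 + y • antidiagonal c 1 = antidiagonal c 2 := by
  obtain ⟨x, y, hxy⟩ := Submodule.mem_span_pair.1
    (mem_span_pair_of_isUnit_planeDet (hc.antidiagonal_eq_zero 0)
      (hc.antidiagonal_eq_zero 1) (hc.antidiagonal_eq_zero 2)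
      (isUnit_planeDet_antidiagonal hd (by decide)))
  have hx : IsUnit x := by
    refine isUnit_of_mul_isUnit_left (y := planeDet (antidiagonal c 0) (antidiagonal c 1)) ?_
    convert isUnit_planeDet_antidiagonal hd (show (2 : Fin 3) ≠ 1 by decide) using 1
    simp only [planeDet, ← hxy, Pi.add_apply, Pi.smul_apply, smul_eq_mul]
    ring
  have hy : IsUnit y := by
    refine isUnit_of_mul_isUnit_left (y := planeDet (antidiagonal c 0) (antidiagonal c 1)) ?_
    convert isUnit_planeDet_antidiagonal hd (show (0 : Fin 3) ≠ 2 by decide) using 1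
    simp only [planeDet, ← hxy, Pi.add_apply, Pi.smul_apply, smul_eq_mul]
    ring
  exact ⟨x, y, hx, hy, hxy⟩

theorem IsAntitriangular.exists_equiv_diagonal (hc : IsAntitriangular c)
    (hd : IsUnit (discriminant c)) :
    ∃ g : GL (Fin 8) A, ∀ x y, ofConstants c (g.val *ᵥ x) (g.val *ᵥ y) =
      g.val *ᵥ ofConstants (diagonalConstants A) x y := by
  obtain ⟨e, f, hee, hff, hef, hspan⟩ := hc.exists_diagonal hd
  have hz := hc.antidiagonal_eq_zero
  have h01 := isUnit_planeDet_antidiagonal hd (show (0 : Fin 3) ≠ 1 by decide)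
  obtain ⟨x, y, hx, hy, hxy⟩ := hc.exists_isUnit_smul_add_smul_antidiagonal hd
  have hker : ∀ i, ofConstants c (antidiagonal c i) = 0 := fun i =>
    hc.apply_eq_zero_of_plane (hz i)
  let u : Fin 3 → A := ![x, y, 1]
  refine TwoNilp.exists_equiv_diagonal hc.isAlt (e := fun i => u i • e i) (f := f)
    (p := x • antidiagonal c 0) (q := y • antidiagonal c 1) (by simp [hee]) hff
    (by simp [hef, Fin.forall_fin_succ, u, ← hxy]) (by simp [hker]) (by simp [hker]) ?_
  set S := Submodule.span A (Set.range (fun i => u i • e i) ∪ Set.range f ∪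
    {x • antidiagonal c 0, y • antidiagonal c 1})
  have hS : ∀ {a : A} {v : Fin 8 → A}, IsUnit a → a • v ∈ S → v ∈ S := fun ha hv =>
    (S.smul_mem_iff_of_isUnit ha).1 hv
  have hu : ∀ i, IsUnit (u i) := by simp [Fin.forall_fin_succ, u, hx, hy]
  have he : Submodule.span A (Set.range e) ≤ S := Submodule.span_le.2 <| by
    rintro _ ⟨i, rfl⟩
    exact hS (hu i) (Submodule.subset_span (by simp))
  have hf : Submodule.span A (Set.range f) ≤ S := Submodule.span_mono (by grind)
  have ha : Submodule.span A {antidiagonal c 0, antidiagonal c 1} ≤ S := Submodule.span_le.2 <| by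
    rintro _ (rfl | rfl)
    exacts [hS hx (Submodule.subset_span (by simp)), hS hy (Submodule.subset_span (by simp))]
  refine eq_top_of_single_mem fun k => ?_
  obtain hk | hk := lt_or_ge k 6
  · exact sup_le hf he (hspan k hk)
  · exact ha (mem_span_pair_of_isUnit_planeDet (hz 0) (hz 1) (by grind) h01)

end Antitriangular

section Discriminant

open Polynomial

variable {𝕜 : Type*} [Field 𝕜]

theorem X_pow_two_add_C_mul_X_add_C_ne_zero (a b : 𝕜) : (X ^ 2 + C a * X + C b : 𝕜[X]) ≠ 0 := by
  rw [add_assoc]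
  exact (monic_X_pow_add (degree_linear_le.trans_lt (by norm_num))).ne_zero

theorem discriminant_add_smul_diagonalConstants_ne_zero (c : Fin 8 × Fin 8 × Fin 8 → 𝕜) :
    discriminant (C ∘ c + (X : 𝕜[X]) • diagonalConstants 𝕜[X]) ≠ 0 := by
  refine mul_ne_zero (mul_ne_zero ?_ ?_) ?_ <;>
    simp only [planeDet, antidiagonal, diagonalConstants, wedgeConstants]
  · convert X_pow_two_add_C_mul_X_add_C_ne_zero (c (0, 5, 6) + c (1, 4, 7))
      (c (0, 5, 6) * c (1, 4, 7) - c (0, 5, 7) * c (1, 4, 6)) using 1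
    simp
    ring
  · convert X_pow_two_add_C_mul_X_add_C_ne_zero (c (2, 3, 6) + c (1, 4, 7) - c (1, 4, 6))
      (c (2, 3, 6) * c (1, 4, 7) - c (2, 3, 7) * c (1, 4, 6)) using 1
    simp
    ring
  · convert X_pow_two_add_C_mul_X_add_C_ne_zero (c (0, 5, 6) + c (2, 3, 7) - c (0, 5, 7))
      (c (0, 5, 6) * c (2, 3, 7) - c (0, 5, 7) * c (2, 3, 6)) using 1
    simp
    ring

theorem exists_eval_eq_discriminant (c : Fin 8 × Fin 8 × Fin 8 → 𝕜) :
    ∃ q : 𝕜[X], q ≠ 0 ∧ ∀ s, q.eval s = discriminant (c + s • diagonalConstants 𝕜) := by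
  refine ⟨_, discriminant_add_smul_diagonalConstants_ne_zero c, fun s => ?_⟩
  rw [← coe_evalRingHom, map_discriminant]
  congr 1
  ext t
  simp [← map_comp_diagonalConstants (evalRingHom s)]

theorem IsAntitriangular.mem_orbit {c : Fin 8 × Fin 8 × Fin 8 → 𝕜} (hc : IsAntitriangular c)
    (hd : discriminant c ≠ 0) : ofConstants c ∈ orbit (ofConstants (diagonalConstants 𝕜)) := by
  obtain ⟨g, hg⟩ := hc.exists_equiv_diagonal hd.isUnit
  exact ⟨g, eq_transport_iff.2 hg⟩

end Discriminant

section NormalForm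

variable {K : Type*} [Field K]

theorem k8_mem_twoNilp : k8 K ∈ twoNilp K 8 :=
  mem_twoNilp.2 ⟨fun x => by ext k; simp [k8, mul_comm], fun x y z => by ext k; simp [k8]⟩

theorem span_eq_top_of_dotProduct {n : ℕ} {s : Set (Fin n → K)}
    (h : ∀ v, (∀ b ∈ s, b ⬝ᵥ v = 0) → v = 0) : Submodule.span K s = ⊤ := by
  by_contra hs
  obtain ⟨φ, hφ, hker⟩ := Submodule.exists_le_ker_of_lt_top _ (lt_top_iff_ne_top.2 hs)
  have hφ' : ∀ b, b ⬝ᵥ (fun i => φ (Pi.single i 1)) = φ b := fun b => by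
    conv_rhs => rw [pi_eq_sum_univ' b]
    simp [dotProduct]
  refine hφ (LinearMap.pi_ext' fun i => LinearMap.ext_ring ?_)
  exact congrFun (h _ fun b hb => (hφ' b).trans (hker (Submodule.subset_span hb))) i

/-- Three vectors of `⟨X₁, X₆, X₈⟩` which diagonalize the bracket of `k₈`, together with those of
`k8Right`, when `ω` is a primitive cube root of unity. -/
def k8Left (ω : K) (i : Fin 3) : Fin 8 → K :=
  ![![-ω, -ω ^ 2, 1] i, 0, 0, 0, 0, ![-ω, -ω, ω] i, 0, ![-ω, -1, ω ^ 2] i]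

/-- Three vectors of `⟨X₂, X₄, X₇⟩` which diagonalize the bracket of `k₈`, together with those of
`k8Left`, when `ω` is a primitive cube root of unity. -/
def k8Right (ω : K) (i : Fin 3) : Fin 8 → K :=
  ![0, -1, 0, ![1, ω, ω ^ 2] i, 0, 0, ![1, ω ^ 2, ω] i, 0]

theorem k8_apply_frame (a b c u v w : K) :
    k8 K ![a, 0, 0, 0, 0, b, 0, c] ![0, u, 0, v, 0, 0, w, 0] =
      ![0, 0, b * v + c * w - a * u, 0, c * u - a * v - b * w, 0, 0, 0] := by
  ext k
  fin_cases k <;> simp [k8] <;> ring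

theorem exists_sq_add_self_add_one_eq_zero [IsAlgClosed K] : ∃ ω : K, ω ^ 2 + ω + 1 = 0 := by
  have hdeg : (Polynomial.X ^ 2 + Polynomial.X + 1 : Polynomial K).degree = 2 := by
    compute_degree!
  obtain ⟨ω, hω⟩ := IsAlgClosed.exists_root (Polynomial.X ^ 2 + Polynomial.X + 1 : Polynomial K)
    (hdeg.trans_ne two_ne_zero)
  exact ⟨ω, by simpa using hω⟩

theorem k8Frame_span_eq_top {ω : K} (hω : ω ^ 2 + ω + 1 = 0) (h3 : (3 : K) ≠ 0) :
    Submodule.span K (Set.range (k8Left ω) ∪ Set.range (k8Right ω) ∪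
      {![0, 0, -3 * ω, 0, 3 * ω, 0, 0, 0], ![0, 0, -3 * ω ^ 2, 0, 3, 0, 0, 0]}) = ⊤ := by
  refine span_eq_top_of_dotProduct fun v hv => ?_
  simp only [Set.mem_union, or_imp, forall_and, Set.forall_mem_range, Set.forall_mem_insert] at hv
  simp only [dotProduct, Fin.sum_univ_eight, Fin.forall_fin_succ, k8Left, k8Right,
    Matrix.cons_val_zero, Matrix.cons_val_one, Matrix.cons_val, Matrix.cons_val_succ,
    Matrix.cons_val_fin_one, Set.mem_singleton_iff, forall_eq, forall_const] at hv
  have h2 : 3 * (3 * v 2) = 0 := by grind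
  replace h2 : v 2 = 0 := by simpa [h3] using h2
  ext k
  fin_cases k <;> simp <;> grind

/- The bracket of `k₈` pairs `⟨X₁, X₆, X₈⟩` with `⟨X₂, X₄, X₇⟩`, by a diagonal matrix in the
direction of `X₃` and by a cyclic permutation in that of `X₅`: the discrete Fourier transform
diagonalizes both. -/
theorem diagonal_mem_orbit_k8 [IsAlgClosed K] (h3 : (3 : K) ≠ 0) :
    ofConstants (diagonalConstants K) ∈ orbit (k8 K) := by
  obtain ⟨ω, hω⟩ := exists_sq_add_self_add_one_eq_zero (K := K)
  obtain ⟨g, hg⟩ := exists_equiv_diagonal (mem_twoNilp.1 k8_mem_twoNilp).1 (e := k8Left ω)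
    (f := k8Right ω) (p := ![0, 0, -3 * ω, 0, 3 * ω, 0, 0, 0])
    (q := ![0, 0, -3 * ω ^ 2, 0, 3, 0, 0, 0])
    (fun i j => by ext k; simp [k8, k8Left])
    (fun i j => by ext k; simp [k8, k8Right])
    (fun i j => by
      rw [k8Left, k8Right, k8_apply_frame]
      fin_cases i <;> fin_cases j <;> ext k <;> fin_cases k <;> simp <;> grind)
    (by ext k l; simp [k8]) (by ext k l; simp [k8])
    (k8Frame_span_eq_top hω h3)
  exact mem_orbit_symm ⟨g, eq_transport_iff.2 hg⟩

end NormalForm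

section Flag

open Module Submodule

variable {K V W : Type*} [Field K] [AddCommGroup V] [Module K V] [FiniteDimensional K V]
  [AddCommGroup W] [Module K W]

theorem exists_le_le_finrank_eq {p q : Submodule K V} (hpq : p ≤ q) {k : ℕ}
    (hp : finrank K p ≤ k) (hq : k ≤ finrank K q) : ∃ r, p ≤ r ∧ r ≤ q ∧ finrank K r = k := by
  induction k, hp using Nat.le_induction with
  | base => exact ⟨p, le_rfl, hpq, rfl⟩
  | succ k _ ih =>
    obtain ⟨r, hpr, hrq, rfl⟩ := ih (by omega)
    obtain ⟨v, hvq, hvr⟩ := SetLike.exists_of_lt (hrq.lt_of_ne (by rintro rfl; omega))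
    exact ⟨r ⊔ K ∙ v, hpr.trans le_sup_left, sup_le hrq ((span_singleton_le_iff_mem _ _).2 hvq),
      finrank_sup_span_singleton hvr⟩

theorem exists_sup_span_singleton_eq {p q : Submodule K V} (hpq : p ≤ q)
    (h : finrank K q = finrank K p + 1) : ∃ v, p ⊔ K ∙ v = q := by
  obtain ⟨v, hvq, hvp⟩ := SetLike.exists_of_lt (hpq.lt_of_ne (by rintro rfl; omega))
  exact ⟨v, eq_of_le_of_finrank_eq (sup_le hpq ((span_singleton_le_iff_mem _ _).2 hvq))
    (by rw [finrank_sup_span_singleton hvp, h])⟩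

/- Two forms on the same space over an algebraically closed field have a degenerate linear
combination: its coefficients are the homogeneous coordinates of an eigenvalue. -/
theorem exists_dual_comp_eq_zero [IsAlgClosed K] [Nontrivial V] (φ : V →ₗ[K] V →ₗ[K] W)
    (hW : 2 ≤ finrank K W) :
    ∃ l : Dual K W, l ≠ 0 ∧ ∃ x ≠ 0, ∀ y, l (φ x y) = 0 := by
  have := FiniteDimensional.of_finrank_pos (show 0 < finrank K W by omega)
  obtain ⟨l, hl⟩ := exists_linearIndependent_of_le_finrank
    (hW.trans_eq Subspace.dual_finrank_eq.symm)
  by_cases hinj : Function.Injective (φ.compr₂ (l 1))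
  · let e := LinearEquiv.ofInjectiveOfFinrankEq _ hinj Subspace.dual_finrank_eq.symm
    obtain ⟨c, hc⟩ := Module.End.exists_eigenvalue (e.symm.toLinearMap ∘ₗ φ.compr₂ (l 0))
    obtain ⟨x, hx⟩ := hc.exists_hasEigenvector
    refine ⟨l 0 - c • l 1, fun h => ?_, x, hx.2, fun y => ?_⟩
    · exact (linearIndependent_fin2.1 hl).2 c (sub_eq_zero.1 h).symm
    · have hex : φ.compr₂ (l 0) x = c • φ.compr₂ (l 1) x := by
        have he : ∀ v, e v = φ.compr₂ (l 1) v := fun _ => rfl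
        rw [← he, ← map_smul, ← hx.apply_eq_smul]
        simp
      simpa [sub_eq_zero] using LinearMap.congr_fun hex y
  · obtain ⟨x, hx, hx0⟩ := Submodule.exists_mem_ne_zero_of_ne_bot (mt LinearMap.ker_eq_bot.1 hinj)
    exact ⟨l 1, hl.ne_zero 1, x, hx0, fun y => LinearMap.congr_fun (LinearMap.mem_ker.1 hx) y⟩

theorem finrank_le_finrank_inf_ker_add_one {f : V →ₗ[K] W} {H : Submodule K V} {l : Dual K W}
    (hW : finrank K W = 2) (hl : l ≠ 0) (h : ∀ v ∈ H, l (f v) = 0) :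
    finrank K H ≤ finrank K ↥(H ⊓ LinearMap.ker f) + 1 := by
  have := FiniteDimensional.of_finrank_pos (show 0 < finrank K W by omega)
  have hker := Dual.finrank_ker_add_one_of_ne_zero hl
  have hrank := (f.domRestrict H).finrank_range_add_finrank_ker
  have hrange : LinearMap.range (f.domRestrict H) ≤ LinearMap.ker l := by
    rintro _ ⟨v, rfl⟩
    exact h v v.2
  have hle := finrank_mono hrange
  rw [LinearMap.ker_domRestrict, ← finrank_map_subtype_eq, map_comap_subtype] at hrank
  omega

theorem exists_flag_step [IsAlgClosed K] {B : V →ₗ[K] V →ₗ[K] W} (hB : B.IsAlt)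
    (hW : finrank K W = 2) {C H : Submodule K V} (hCH : C ≤ H)
    (hC : ∀ c ∈ C, ∀ h ∈ H, B c h = 0) (hdim : finrank K C + 2 ≤ finrank K H) :
    ∃ e ∉ C, ∃ H' ≤ H, C ⊔ K ∙ e ≤ H' ∧ finrank K H' + 1 = finrank K H ∧
      ∀ h ∈ H', B e h = 0 := by
  obtain ⟨D, hCD⟩ := C.exists_isCompl
  have hsup : C ⊔ D ⊓ H = H := by rw [← sup_inf_assoc_of_le D hCH, hCD.sup_eq_top, top_inf_eq]
  have : Nontrivial ↥(D ⊓ H) := nontrivial_iff_ne_bot.2 fun h => by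
    rw [h, sup_bot_eq] at hsup
    subst hsup
    omega
  obtain ⟨l, hl, q, hq0, hq⟩ := exists_dual_comp_eq_zero
    (B.domRestrict₁₂ (D ⊓ H) (D ⊓ H)) hW.ge
  have hqC : (q : V) ∉ C := fun h => hq0 (Subtype.ext (hCD.disjoint.le_bot ⟨h, q.2.1⟩))
  have hBqC : ∀ c ∈ C, B q c = 0 := fun c hc => by
    rw [← hB.neg, hC c hc q q.2.2, neg_zero]
  have hline : ∀ h ∈ H, l (B q h) = 0 := fun h hh => by
    obtain ⟨c, hc, d, hd, rfl⟩ := mem_sup.1 (hsup.symm ▸ hh)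
    rw [map_add, hBqC c hc, zero_add]
    exact hq ⟨d, hd⟩
  have hle : C ⊔ K ∙ (q : V) ≤ H ⊓ LinearMap.ker (B q) :=
    sup_le (fun c hc => ⟨hCH hc, hBqC c hc⟩)
      ((span_singleton_le_iff_mem _ _).2 ⟨q.2.2, hB q⟩)
  have hH := finrank_le_finrank_inf_ker_add_one hW hl hline
  obtain ⟨H', hCH', hH', hfin⟩ := exists_le_le_finrank_eq hle (k := finrank K H - 1)
    (by rw [finrank_sup_span_singleton hqC]; omega) (by omega)
  exact ⟨q, hqC, H', hH'.trans inf_le_left, hCH', by omega, fun h hh => (hH' hh).2⟩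

theorem exists_antitriangular [IsAlgClosed K] {B : V →ₗ[K] V →ₗ[K] W} (hB : B.IsAlt)
    (hW : finrank K W = 2) (m : ℕ) {C H : Submodule K V} (hCH : C ≤ H)
    (hC : ∀ c ∈ C, ∀ h ∈ H, B c h = 0) (hdim : finrank K H = finrank K C + 2 * m) :
    ∃ e f : Fin m → V, (∀ i j, B (e i) (e j) = 0) ∧ (∀ i j, i < j → B (e i) (f j) = 0) ∧
      C ⊔ span K (Set.range e) ⊔ span K (Set.range f) = H := by
  induction m generalizing C H with
  | zero =>
    exact ⟨Fin.elim0, Fin.elim0, fun i => i.elim0, fun i => i.elim0, by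
      simp [eq_of_le_of_finrank_eq hCH hdim.symm]⟩
  | succ m ih =>
    obtain ⟨e₀, he₀, H', hH', hCH', hdim', hBe₀⟩ := exists_flag_step hB hW hCH hC (by omega)
    obtain ⟨f₀, hf₀⟩ := exists_sup_span_singleton_eq hH' hdim'.symm
    have hC' : ∀ c ∈ C ⊔ K ∙ e₀, ∀ h ∈ H', B c h = 0 := fun c hc h hh => by
      obtain ⟨c, hcC, a, ha, rfl⟩ := mem_sup.1 hc
      obtain ⟨a, rfl⟩ := mem_span_singleton.1 ha
      simp [hC c hcC h (hH' hh), hBe₀ h hh]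
    obtain ⟨e, f, hee, hef, hspan⟩ := ih hCH' hC'
      (by rw [finrank_sup_span_singleton he₀]; omega)
    have heH' : ∀ i, e i ∈ H' := fun i =>
      hspan ▸ mem_sup_left (mem_sup_right (subset_span ⟨i, rfl⟩))
    have hfH' : ∀ i, f i ∈ H' := fun i => hspan ▸ mem_sup_right (subset_span ⟨i, rfl⟩)
    have hBe₀' : ∀ i, B (e i) e₀ = 0 := fun i => by rw [← hB.neg, hBe₀ _ (heH' i), neg_zero]
    refine ⟨Fin.cons e₀ e, Fin.cons f₀ f, ?_, ?_, ?_⟩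
    · simp only [Fin.forall_fin_succ, Fin.cons_zero, Fin.cons_succ]
      exact ⟨⟨hB e₀, fun i => hBe₀ _ (heH' i)⟩, fun i => ⟨hBe₀' i, hee i⟩⟩
    · simp only [Fin.forall_fin_succ, Fin.cons_zero, Fin.cons_succ, Fin.succ_lt_succ_iff]
      exact ⟨⟨fun h => (h.false).elim, fun i _ => hBe₀ _ (hfH' i)⟩,
        fun i => ⟨fun h => (Fin.not_lt_zero _ h).elim, fun j => hef i j⟩⟩
    · rw [span_range_cons, span_range_cons, ← hf₀, ← hspan]
      ac_rfl

end Flag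

section CentralPlane

open Module Submodule

variable {K V : Type*} [Field K] [AddCommGroup V] [Module K V] [FiniteDimensional K V]

theorem exists_orthogonal_eq {ω : LinearMap.BilinForm K V} (hω : ω.IsAlt) :
    ∃ L, ω.orthogonal L = L := by
  obtain ⟨L, -, hL⟩ := exists_maximal_ge_of_wellFoundedGT (fun L => L ≤ ω.orthogonal L) ⊥ bot_le
  refine ⟨L, le_antisymm (fun x hx => ?_) hL.prop⟩
  have hiso : L ⊔ K ∙ x ≤ ω.orthogonal (L ⊔ K ∙ x) := by
    refine sup_le (fun y hy v hv => ?_)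
      ((span_singleton_le_iff_mem _ _).2 fun v hv => ?_) <;>
      obtain ⟨z, hz, _, hw, rfl⟩ := mem_sup.1 hv <;> obtain ⟨a, rfl⟩ := mem_span_singleton.1 hw
    · have hxy : ω x y = 0 := by rw [← hω.neg_eq, hx y hy, neg_zero]
      simp [hL.prop hy z hz, hxy]
    · simp [hx z hz, hω.self_eq_zero]
  exact hL.le_of_ge hiso le_sup_left (mem_sup_right (mem_span_singleton_self x))

theorem even_finrank_add_finrank_ker {ω : LinearMap.BilinForm K V} (hω : ω.IsAlt) :
    Even (finrank K V + finrank K (LinearMap.ker ω)) := by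
  obtain ⟨L, hL⟩ := exists_orthogonal_eq hω
  have hker : LinearMap.ker ω ≤ L := hL ▸ fun x hx y _ => by
    rw [← hω.neg_eq, LinearMap.mem_ker.1 hx, LinearMap.zero_apply, neg_zero]
  have := LinearMap.BilinForm.finrank_add_finrank_orthogonal' (B := ω) L
  rw [hL, inf_eq_right.2 hker] at this
  exact ⟨_, this.symm⟩

theorem exists_dual_of_finrank_le_one {p : Submodule K V} (hp : finrank K p ≤ 1) :
    ∃ l : Dual K V, ∀ v ∈ p, l v = 0 → v = 0 := by
  obtain ⟨w, rfl⟩ := (finrank_le_one_iff_isPrincipal p).1 hp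
  by_cases hw : w = 0
  · exact ⟨0, fun v hv _ => by simpa [hw] using hv⟩
  · obtain ⟨l, hl⟩ := Projective.exists_dual_ne_zero K hw
    refine ⟨l, fun v hv hlv => ?_⟩
    obtain ⟨a, rfl⟩ := mem_span_singleton.1 hv
    simp_all

variable {n : ℕ} {μ : Bracket K n}

theorem even_finrank_ker_of_finrank_derived_le_one (h : μ.IsAlt) (hn : Even n)
    (hd : finrank K (derived μ) ≤ 1) : Even (finrank K (LinearMap.ker μ)) := by
  obtain ⟨l, hl⟩ := exists_dual_of_finrank_le_one hd
  have hker : LinearMap.ker (μ.compr₂ l) = LinearMap.ker μ := by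
    ext x
    simp only [LinearMap.mem_ker, LinearMap.ext_iff, LinearMap.compr₂_apply, LinearMap.zero_apply]
    exact forall_congr' fun y => ⟨hl _ (apply_mem_derived μ x y), fun h => by rw [h, map_zero]⟩
  have halt : (μ.compr₂ l).IsAlt := fun x => by simp [h.self_eq_zero]
  have := even_finrank_add_finrank_ker halt
  rwa [hker, finrank_fin_fun, Nat.even_add, iff_true_left hn] at this

theorem two_le_finrank_ker (h : μ ∈ twoNilp K n) (hn : Even n) (hn2 : 2 ≤ n) :
    2 ≤ finrank K (LinearMap.ker μ) := by
  have hle := finrank_mono (derived_le_ker h)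
  by_contra! hker
  have heven := even_finrank_ker_of_finrank_derived_le_one h.1.1 hn (by omega)
  have hzero : finrank K (LinearMap.ker μ) = 0 := by
    obtain ⟨k, hk⟩ := heven
    omega
  have hder : derived μ = ⊥ := finrank_eq_zero.1 (by omega)
  have hμ : μ = 0 := LinearMap.ext₂ fun x y => by
    simpa [hder] using apply_mem_derived μ x y
  rw [hμ, LinearMap.ker_zero, finrank_top, finrank_fin_fun] at hzero
  omega

theorem exists_central_plane (h : μ ∈ twoNilp K n) (hn : Even n) (hn2 : 2 ≤ n)
    (hd : finrank K (derived μ) ≤ 2) :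
    ∃ Z, derived μ ≤ Z ∧ Z ≤ LinearMap.ker μ ∧ finrank K Z = 2 :=
  exists_le_le_finrank_eq (derived_le_ker h) hd (two_le_finrank_ker h hn hn2)

end CentralPlane

section Antitriangularization

open Module Submodule

variable {K : Type*} [Field K] {μ : Bracket K 8}

theorem isAntitriangular_structureConstants_transport (h : μ.IsAlt) {g : GL (Fin 8) K}
    {b : Fin 8 → Fin 8 → K} (hg : ∀ i, g.val *ᵥ Pi.single i 1 = b i)
    (hplane : derived μ ≤ span K {b 6, b 7}) (hcentral : ∀ i, 6 ≤ i → μ (b i) = 0)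
    (htri : ∀ i j : Fin 8, i.val + j.val < 5 → μ (b i) (b j) = 0) :
    IsAntitriangular (structureConstants (transport g⁻¹ μ)) := by
  have hc : ∀ i j k, structureConstants (transport g⁻¹ μ) (i, j, k) =
      (g⁻¹.val *ᵥ μ (b i) (b j)) k := fun i j k => by
    simp only [structureConstants, transport_apply, inv_inv, hg]
  have hg' : ∀ i, g⁻¹.val *ᵥ b i = Pi.single i 1 := fun i => by rw [← hg, GL_inv_mulVec_mulVec]
  refine ⟨fun i k => ?_, fun i j k => ?_, fun i j k h6 h7 => ?_, fun i j k hi => ?_,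
    fun i j k hij => ?_⟩
  · rw [hc, h.self_eq_zero, Matrix.mulVec_zero, Pi.zero_apply]
  · rw [hc, hc, ← h.neg, Matrix.mulVec_neg, Pi.neg_apply]
  · obtain ⟨s, t, hst⟩ := mem_span_pair.1 (hplane (apply_mem_derived μ (b i) (b j)))
    rw [hc, ← hst, Matrix.mulVec_add, Matrix.mulVec_smul, Matrix.mulVec_smul, hg', hg']
    simp [h6, h7]
  · rw [hc, hcentral i hi, LinearMap.zero_apply, Matrix.mulVec_zero, Pi.zero_apply]
  · rw [hc, htri i j hij, Matrix.mulVec_zero, Pi.zero_apply]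

theorem exists_antitriangular_vectors [IsAlgClosed K] {n m : ℕ} {μ : Bracket K n}
    (h : μ ∈ twoNilp K n) (hn : n = 2 * m + 2) (hd : finrank K (derived μ) ≤ 2) :
    ∃ (e f : Fin m → Fin n → K) (z : Fin 2 → Fin n → K),
      span K (Set.range e ∪ Set.range f ∪ Set.range z) = ⊤ ∧ derived μ ≤ span K (Set.range z) ∧
      (∀ i, μ (z i) = 0) ∧ (∀ i j, μ (e i) (e j) = 0) ∧ ∀ i j, i < j → μ (e i) (f j) = 0 := by
  obtain ⟨Z, hdZ, hZ, hZ2⟩ := exists_central_plane h ⟨m + 1, by omega⟩ (by omega) hd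
  let B : (Fin n → K) →ₗ[K] (Fin n → K) →ₗ[K] Z :=
    LinearMap.mk₂ K (fun x y => ⟨μ x y, hdZ (apply_mem_derived μ x y)⟩)
      (by simp) (by simp) (by simp) (by simp)
  have hμB : ∀ {x y}, B x y = 0 → μ x y = 0 := fun {x y} h => congrArg Subtype.val h
  obtain ⟨e, f, hee, hef, htop⟩ := exists_antitriangular (B := B) (C := Z) (H := ⊤)
    (fun x => Subtype.ext (h.1.1 x)) hZ2 m le_top
    (fun z hz y _ => Subtype.ext (LinearMap.congr_fun (LinearMap.mem_ker.1 (hZ hz)) y))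
    (by rw [finrank_top, finrank_fin_fun]; omega)
  let z := finBasisOfFinrankEq K Z hZ2
  have hspanZ : span K (Set.range fun i => (z i : Fin n → K)) = Z := by
    have := congrArg (Submodule.map Z.subtype) z.span_eq
    rwa [map_span, ← Set.range_comp, Submodule.map_top, range_subtype] at this
  refine ⟨e, f, fun i => z i, ?_, hdZ.trans hspanZ.ge, fun i => hZ (z i).2,
    fun i j => hμB (hee i j), fun i j hij => hμB (hef i j hij)⟩
  rw [span_union, span_union, hspanZ, ← htop]
  ac_rfl

theorem exists_antitriangular_frame [IsAlgClosed K] (h : μ ∈ twoNilp K 8)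
    (hd : finrank K (derived μ) ≤ 2) :
    ∃ b : Fin 8 → Fin 8 → K, span K (Set.range b) = ⊤ ∧ derived μ ≤ span K {b 6, b 7} ∧
      (∀ i, 6 ≤ i → μ (b i) = 0) ∧ ∀ i j : Fin 8, i.val + j.val < 5 → μ (b i) (b j) = 0 := by
  obtain ⟨e, f, z, htop, hplane, hz, hee, hef⟩ := exists_antitriangular_vectors (m := 3) h rfl hd
  have hfe : ∀ i j, i < j → μ (f j) (e i) = 0 := fun i j hij => by
    rw [(mem_twoNilp.1 h).1.eq_iff, hef i j hij]
  refine ⟨![e 0, e 1, e 2, f 2, f 1, f 0, z 0, z 1], ?_, ?_, ?_, ?_⟩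
  · refine top_unique (htop.ge.trans (span_mono ?_))
    simp [Set.union_subset_iff, Set.range_subset_iff, Fin.forall_fin_succ]
  · refine hplane.trans (span_mono ?_)
    simp [Set.range_subset_iff, Fin.forall_fin_succ]
  · simp only [Fin.forall_fin_succ]
    simp [hz]
  · simp [Fin.forall_fin_succ, hee, hef, hfe]

theorem exists_isAntitriangular [IsAlgClosed K] (h : μ ∈ twoNilp K 8)
    (hd : finrank K (derived μ) ≤ 2) :
    ∃ (g : GL (Fin 8) K) (c : Fin 8 × Fin 8 × Fin 8 → K),
      IsAntitriangular c ∧ μ = transport g (ofConstants c) := by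
  obtain ⟨b, hb, hplane, hcentral, htri⟩ := exists_antitriangular_frame h hd
  obtain ⟨g, hg⟩ := exists_GL_of_span_eq_top hb
  refine ⟨g, _, isAntitriangular_structureConstants_transport h.1.1 hg hplane hcentral htri, ?_⟩
  rw [ofConstants_structureConstants, ← transport_mul, mul_inv_cancel, transport_one]

end Antitriangularization

section Minors

open Module

variable {m n K L : Type*} [Fintype n] [Field K] [Field L]

theorem exists_submatrix_linearIndependent_row [Finite m] {A : Matrix m n K} {d : ℕ}
    (hd : d ≤ A.rank) : ∃ r : Fin d → m, LinearIndependent K (A.submatrix r id).row := by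
  rw [Matrix.rank_eq_finrank_span_row] at hd
  obtain ⟨v, hv, -, hli⟩ := Submodule.exists_fun_fin_finrank_span_eq K (Set.range A.row)
  choose r hr using hv
  refine ⟨fun i => r (Fin.castLE hd i), ?_⟩
  have hrow : (A.submatrix (fun i => r (Fin.castLE hd i)) id).row = v ∘ Fin.castLE hd :=
    funext fun i => hr _
  rw [hrow]
  exact hli.comp _ (Fin.castLE_injective hd)

theorem le_rank_iff_exists_minor [Finite m] {A : Matrix m n K} {d : ℕ} :
    d ≤ A.rank ↔ ∃ (r : Fin d → m) (c : Fin d → n), (A.submatrix r c).det ≠ 0 := by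
  cases nonempty_fintype m
  refine ⟨fun hd => ?_, fun ⟨r, c, h⟩ => ?_⟩
  · obtain ⟨r, hr⟩ := exists_submatrix_linearIndependent_row hd
    have hrank : d ≤ (A.submatrix r id)ᵀ.rank := by
      rw [Matrix.rank_transpose, hr.rank_matrix, Fintype.card_fin]
    obtain ⟨c, hc⟩ := exists_submatrix_linearIndependent_row hrank
    refine ⟨r, c, ?_⟩
    rw [← Matrix.det_transpose]
    exact ((Matrix.isUnit_iff_isUnit_det _).1
      (Matrix.linearIndependent_rows_iff_isUnit.1 hc)).ne_zero
  · simpa [Matrix.rank_of_det_ne_zero h] using A.rank_submatrix_le r c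

theorem rank_map_le [Finite m] (φ : K →+* L) (A : Matrix m n K) : (A.map φ).rank ≤ A.rank := by
  obtain ⟨r, c, h⟩ := le_rank_iff_exists_minor.1 (le_refl (A.map φ).rank)
  refine le_rank_iff_exists_minor.2 ⟨r, c, fun h0 => h ?_⟩
  rw [Matrix.submatrix_map, ← RingHom.mapMatrix_apply, ← RingHom.map_det, h0, map_zero]

end Minors

section ZariskiClosure

open Module

variable {𝕜 : Type*} [Field 𝕜] {n : ℕ} {S T : Set (Bracket 𝕜 n)} {μ : Bracket 𝕜 n}

theorem mem_zariskiClosure_iff : μ ∈ zariskiClosure S ↔ μ ∈ twoNilp 𝕜 n ∧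
    ∀ p : MvPolynomial (Fin n × Fin n × Fin n) 𝕜,
      (∀ ν ∈ S, p.eval (structureConstants ν) = 0) → p.eval (structureConstants μ) = 0 := by
  simp [zariskiClosure, MvPolynomial.mem_zeroLocus_iff, MvPolynomial.mem_vanishingIdeal_iff,
    MvPolynomial.aeval_eq_eval]

theorem zariskiClosure_subset_of_subset (h : S ⊆ zariskiClosure T) :
    zariskiClosure S ⊆ zariskiClosure T := fun μ hμ => by
  rw [mem_zariskiClosure_iff] at *
  exact ⟨hμ.1, fun p hp => hμ.2 p fun ν hν => (mem_zariskiClosure_iff.1 (h hν)).2 p hp⟩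

theorem subset_zariskiClosure (h : S ⊆ twoNilp 𝕜 n) : S ⊆ zariskiClosure S := fun _ hμ =>
  mem_zariskiClosure_iff.2 ⟨h hμ, fun _ hp => hp _ hμ⟩

/-- The coordinates of the products of basis vectors, one product in each row. -/
def productMatrix {R : Type*} (c : Fin n × Fin n × Fin n → R) :
    Matrix (Fin n × Fin n) (Fin n) R :=
  Matrix.of fun t k => c (t.1, t.2, k)

theorem derived_eq_span_row (μ : Bracket 𝕜 n) :
    derived μ = Submodule.span 𝕜 (Set.range (productMatrix (structureConstants μ)).row) := by
  refine le_antisymm (derived_le fun x y => ?_) (Submodule.span_le.2 ?_)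
  · suffices h : μ.compr₂ (Submodule.mkQ _) = 0 from
      (Submodule.Quotient.mk_eq_zero _).1 (LinearMap.congr_fun₂ h x y)
    refine LinearMap.ext_basis (Pi.basisFun 𝕜 (Fin n)) (Pi.basisFun 𝕜 (Fin n)) fun i j => ?_
    rw [Pi.basisFun_apply, Pi.basisFun_apply]
    exact (Submodule.Quotient.mk_eq_zero _).2 (Submodule.subset_span ⟨(i, j), rfl⟩)
  · rintro _ ⟨t, rfl⟩
    exact apply_mem_derived μ (Pi.single t.1 1) (Pi.single t.2 1)

theorem finrank_derived_eq_rank (μ : Bracket 𝕜 n) :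
    finrank 𝕜 (derived μ) = (productMatrix (structureConstants μ)).rank := by
  rw [derived_eq_span_row, Matrix.rank_eq_finrank_span_row]

theorem finrank_derived_le_of_mem_zariskiClosure {d : ℕ}
    (hS : ∀ ν ∈ S, finrank 𝕜 (derived ν) ≤ d) (hμ : μ ∈ zariskiClosure S) :
    finrank 𝕜 (derived μ) ≤ d := by
  by_contra! hd
  rw [finrank_derived_eq_rank, ← Nat.add_one_le_iff, le_rank_iff_exists_minor] at hd
  obtain ⟨r, c, hrc⟩ := hd
  let p := ((productMatrix (MvPolynomial.X (R := 𝕜))).submatrix r c).det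
  have hp : ∀ ν : Bracket 𝕜 n, p.eval (structureConstants ν) =
      ((productMatrix (structureConstants ν)).submatrix r c).det := fun ν => by
    rw [RingHom.map_det]
    congr 1
    ext i j
    simp [productMatrix]
  refine hrc (hp μ ▸ (mem_zariskiClosure_iff.1 hμ).2 p fun ν hν => ?_)
  by_contra h
  have := le_rank_iff_exists_minor.2 ⟨r, c, hp ν ▸ h⟩
  rw [← finrank_derived_eq_rank] at this
  exact absurd (hS ν hν) (by omega)

theorem mem_zariskiClosure_of_line [Infinite 𝕜] {ν : Bracket 𝕜 n} (hμ : μ ∈ twoNilp 𝕜 n)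
    {q : Polynomial 𝕜} (hq : q ≠ 0) (h : ∀ s, q.eval s ≠ 0 → μ + s • ν ∈ S) :
    μ ∈ zariskiClosure S := by
  refine mem_zariskiClosure_iff.2 ⟨hμ, fun p hp => ?_⟩
  let r : Polynomial 𝕜 := p.aeval fun t =>
    Polynomial.C (structureConstants μ t) + Polynomial.X * Polynomial.C (structureConstants ν t)
  have hr : ∀ s, r.eval s = p.eval (structureConstants (μ + s • ν)) := fun s => by
    rw [← Polynomial.coe_aeval_eq_eval, MvPolynomial.comp_aeval_apply,
      MvPolynomial.aeval_eq_eval]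
    congr 2
    ext t
    simp [structureConstants, mul_comm s]
  have hqr : q * r = 0 := Polynomial.funext fun s => by
    rw [Polynomial.eval_mul, hr, Polynomial.eval_zero]
    by_cases hs : q.eval s = 0
    · rw [hs, zero_mul]
    · rw [hp _ (h s hs), mul_zero]
  have := hr 0
  rwa [(mul_eq_zero.1 hqr).resolve_left hq, Polynomial.eval_zero, zero_smul, add_zero, eq_comm]
    at this

end ZariskiClosure

section Descent

open Module

variable {R S : Type*} [CommRing R] [CommRing S] {𝕜 L : Type*} [Field 𝕜] [Field L] {n : ℕ}

/-- The structure constants of `(x, y) ↦ adj M (μ (M x, M y))`, where `μ` has structure constants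
`c`. For an invertible `M` they are those of a multiple of a bracket isomorphic to `μ`; the
adjugate replaces the inverse because it is polynomial in the entries of `M`. -/
def pullbackConstants (c : Fin n × Fin n × Fin n → R) (M : Matrix (Fin n) (Fin n) R) :
    Fin n × Fin n × Fin n → R :=
  fun t => (M.adjugate *ᵥ ofConstants c (M *ᵥ Pi.single t.1 1) (M *ᵥ Pi.single t.2.1 1)) t.2.2

theorem map_comp_single (φ : R →+* S) (i : Fin n) :
    φ ∘ (Pi.single i 1 : Fin n → R) = Pi.single i 1 := by
  ext j
  simp [Pi.single_apply, apply_ite φ]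

theorem map_comp_mulVec (φ : R →+* S) (M : Matrix (Fin n) (Fin n) R) (x : Fin n → R) :
    φ ∘ (M *ᵥ x) = M.map φ *ᵥ (φ ∘ x) :=
  funext (RingHom.map_mulVec φ M x)

theorem map_comp_pullbackConstants (φ : R →+* S) (c : Fin n × Fin n × Fin n → R)
    (M : Matrix (Fin n) (Fin n) R) :
    φ ∘ pullbackConstants c M = pullbackConstants (φ ∘ c) (M.map φ) := by
  ext ⟨i, j, k⟩
  have hadj : M.adjugate.map φ = (M.map φ).adjugate := φ.map_adjugate M
  simp only [pullbackConstants, ← map_comp_single φ, ← map_comp_mulVec, ← map_ofConstants,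
    ← hadj, Function.comp_apply]

theorem ofConstants_pullbackConstants (g : GL (Fin n) 𝕜) (μ : Bracket 𝕜 n) :
    ofConstants (pullbackConstants (structureConstants μ) g) = g.det • transport g⁻¹ μ :=
  ext_single fun i j => by
    ext k
    have hadj : g.val.adjugate = g.val.det • g⁻¹.val := by
      rw [Matrix.coe_units_inv, Matrix.inv_def, smul_smul,
        Ring.mul_inverse_cancel _ ((Matrix.isUnit_iff_isUnit_det _).1 g.isUnit), one_smul]
    simp [pullbackConstants, transport_apply, hadj, Units.smul_def, Matrix.smul_mulVec]

theorem transport_smul (a : 𝕜ˣ) (g : GL (Fin n) 𝕜) (μ : Bracket 𝕜 n) :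
    transport (a • g) μ = a⁻¹ • transport g μ :=
  LinearMap.ext₂ fun x y => by
    simp [transport_apply, Units.smul_def, Matrix.smul_mulVec, Matrix.mulVec_smul, smul_smul]

theorem smul_mem_orbit (a : 𝕜ˣ) {μ ν : Bracket 𝕜 n} (h : ν ∈ orbit μ) : a • ν ∈ orbit μ := by
  obtain ⟨g, rfl⟩ := h
  exact ⟨a⁻¹ • g, by rw [transport_smul, inv_inv]⟩

theorem exists_pullbackConstants_eq [IsAlgClosed 𝕜] {μ ν : Bracket 𝕜 n} (h : ν ∈ orbit μ) :
    ∃ M, pullbackConstants (structureConstants μ) M = structureConstants ν := by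
  obtain ⟨g, rfl⟩ := h
  obtain ⟨s, hs⟩ := IsAlgClosed.exists_pow_nat_eq g.val.det n.succ_pos
  have hs0 : s ≠ 0 := by
    rintro rfl
    simp [(Matrix.isUnit_iff_isUnit_det _).1 g.isUnit |>.ne_zero.symm] at hs
  let a : 𝕜ˣ := Units.mk0 s hs0
  have hdet : ((a⁻¹ • g)⁻¹).det * a = 1 := by
    rw [map_inv, inv_mul_eq_one]
    ext
    simp [a, Units.smul_def, ← hs, pow_succ, hs0]
  refine ⟨((a⁻¹ • g)⁻¹ : GL (Fin n) 𝕜), ?_⟩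
  rw [← structureConstants_ofConstants (pullbackConstants _ _), ofConstants_pullbackConstants,
    inv_inv, transport_smul, inv_inv, smul_smul, hdet, one_smul]

theorem eq_zero_of_forall_eval_GL_eq_zero [Infinite 𝕜] {q : MvPolynomial (Fin n × Fin n) 𝕜}
    (h : ∀ g : GL (Fin n) 𝕜, q.eval (fun t => g.val t.1 t.2) = 0) : q = 0 := by
  have hdet : (Matrix.mvPolynomialX (Fin n) (Fin n) 𝕜).det ≠ 0 :=
    Matrix.det_mvPolynomialX_ne_zero _ _
  refine (mul_eq_zero.1 (MvPolynomial.funext fun x => ?_)).resolve_right hdet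
  rw [map_mul, map_zero, mul_eq_zero, or_iff_not_imp_right]
  intro hx
  rw [Matrix.eval_det_mvPolynomialX] at hx
  exact h (Matrix.GeneralLinearGroup.mkOfDetNeZero _ hx)

theorem eval₂_aeval_pullbackConstants (φ : R →+* S) (c : Fin n × Fin n × Fin n → R)
    (M : Matrix (Fin n) (Fin n) S) (p : MvPolynomial (Fin n × Fin n × Fin n) R) :
    (p.aeval (pullbackConstants (MvPolynomial.C ∘ c)
      (Matrix.mvPolynomialX (Fin n) (Fin n) R))).eval₂ φ (fun t => M t.1 t.2) =
      p.eval₂ φ (pullbackConstants (φ ∘ c) M) := by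
  let ψ : MvPolynomial (Fin n × Fin n) R →+* S := MvPolynomial.eval₂Hom φ fun t => M t.1 t.2
  have hC : ψ.comp MvPolynomial.C = φ := MvPolynomial.eval₂Hom_comp_C _ _
  have hX : (Matrix.mvPolynomialX (Fin n) (Fin n) R).map ψ = M :=
    Matrix.mvPolynomialX_map_eval₂ φ M
  have hpull : ψ ∘ pullbackConstants (MvPolynomial.C ∘ c) (Matrix.mvPolynomialX _ _ R) =
      pullbackConstants (φ ∘ c) M := by
    rw [map_comp_pullbackConstants, hX, ← Function.comp_assoc, ← RingHom.coe_comp, hC]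
  rw [MvPolynomial.aeval_def, MvPolynomial.algebraMap_eq]
  refine (MvPolynomial.hom_eval₂ p MvPolynomial.C ψ _).trans ?_
  rw [hC]
  exact congrArg (fun v => p.eval₂ φ v) hpull

theorem eval₂_eq_zero_of_mem_orbit [Infinite 𝕜] [IsAlgClosed L] (φ : 𝕜 →+* L)
    {p : MvPolynomial (Fin n × Fin n × Fin n) 𝕜} {μ : Bracket 𝕜 n}
    (hp : ∀ ν ∈ orbit μ, p.eval (structureConstants ν) = 0) {κ : Bracket L n}
    (hκ : κ ∈ orbit (ofConstants (φ ∘ structureConstants μ))) :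
    p.eval₂ φ (structureConstants κ) = 0 := by
  obtain ⟨M, hM⟩ := exists_pullbackConstants_eq hκ
  let q := p.aeval (pullbackConstants (MvPolynomial.C ∘ structureConstants μ)
    (Matrix.mvPolynomialX (Fin n) (Fin n) 𝕜))
  have hq : q = 0 := eq_zero_of_forall_eval_GL_eq_zero fun g => by
    refine (eval₂_aeval_pullbackConstants (RingHom.id 𝕜) (structureConstants μ) g.val p).trans ?_
    rw [RingHom.coe_id, Function.id_comp,
      ← structureConstants_ofConstants (pullbackConstants _ _), ofConstants_pullbackConstants]
    exact hp _ (smul_mem_orbit _ ⟨g⁻¹, rfl⟩)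
  rw [← hM, structureConstants_ofConstants, ← eval₂_aeval_pullbackConstants]
  exact (congrArg _ hq).trans (MvPolynomial.eval₂_zero _ _)

end Descent

section Extension

open Module

variable {𝕜 L : Type*} [Field 𝕜] [Field L] {n : ℕ} (φ : 𝕜 →+* L) {μ ν : Bracket 𝕜 n}

/-- The bracket over an extension `L` of `𝕜` with the structure constants of `μ`. -/
def extend (μ : Bracket 𝕜 n) : Bracket L n :=
  ofConstants (φ ∘ structureConstants μ)

theorem extend_comp (μ : Bracket 𝕜 n) (x y : Fin n → 𝕜) :
    extend φ μ (φ ∘ x) (φ ∘ y) = φ ∘ μ x y := by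
  rw [extend, ← map_ofConstants, ofConstants_structureConstants]

theorem extend_mem_twoNilp (h : μ ∈ twoNilp 𝕜 n) : extend φ μ ∈ twoNilp L n := by
  rw [mem_twoNilp] at h ⊢
  refine ⟨isAlt_ofConstants (fun i k => ?_) fun i j k => ?_, fun x y z => ?_⟩
  · simp [structureConstants, h.1 _]
  · simp [structureConstants, ← h.1.neg (Pi.single i 1)]
  · have hzero : (extend φ μ).compr₂ (extend φ μ) = 0 := by
      refine LinearMap.ext_basis (Pi.basisFun L (Fin n)) (Pi.basisFun L (Fin n)) fun i j =>
        (Pi.basisFun L (Fin n)).ext fun k => ?_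
      simp only [Pi.basisFun_apply, ← map_comp_single φ, LinearMap.compr₂_apply, extend_comp, h.2]
      ext
      simp
    exact LinearMap.congr_fun (LinearMap.congr_fun₂ hzero x y) z

theorem finrank_derived_extend_le (μ : Bracket 𝕜 n) :
    finrank L (derived (extend φ μ)) ≤ finrank 𝕜 (derived μ) := by
  rw [finrank_derived_eq_rank, finrank_derived_eq_rank, extend, structureConstants_ofConstants]
  exact rank_map_le φ _

theorem mem_zariskiClosure_orbit_of_extend [Infinite 𝕜] [IsAlgClosed L] (hμ : μ ∈ twoNilp 𝕜 n)
    (h : extend φ μ ∈ zariskiClosure (orbit (extend φ ν))) : μ ∈ zariskiClosure (orbit ν) := by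
  refine mem_zariskiClosure_iff.2 ⟨hμ, fun p hp => φ.injective ?_⟩
  have := (mem_zariskiClosure_iff.1 h).2 (p.map φ) fun κ hκ => by
    rw [MvPolynomial.eval_map]
    exact eval₂_eq_zero_of_mem_orbit φ hp hκ
  rwa [MvPolynomial.eval_map, extend, structureConstants_ofConstants, ← MvPolynomial.eval₂_comp,
    ← map_zero φ] at this

theorem extend_k8 : extend φ (k8 𝕜) = k8 L :=
  ext_single fun i j => by
    simp only [← map_comp_single φ, extend_comp]
    ext k
    simp [k8, Pi.single_apply, apply_ite φ]

end Extension

section Density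

open Module

variable {K : Type*} [Field K] {μ : Bracket K 8}

theorem finrank_derived_k8_le (K : Type*) [Field K] : finrank K (derived (k8 K)) ≤ 2 :=
  finrank_derived_le_two fun x y => by
    simp only [k8, LinearMap.sub_apply, LinearMap.neg_apply, along_apply]
    exact sub_mem (neg_mem (Submodule.smul_mem _ _ (Submodule.mem_span_of_mem (.inl rfl))))
      (Submodule.smul_mem _ _ (Submodule.mem_span_of_mem (.inr rfl)))

theorem mem_zariskiClosure_orbit_k8_of_isAlgClosed [IsAlgClosed K] (h3 : (3 : K) ≠ 0)
    (h : μ ∈ twoNilp K 8) (hd : finrank K (derived μ) ≤ 2) :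
    μ ∈ zariskiClosure (orbit (k8 K)) := by
  obtain ⟨g, c, hc, rfl⟩ := exists_isAntitriangular h hd
  obtain ⟨q, hq, hqs⟩ := exists_eval_eq_discriminant c
  refine mem_zariskiClosure_of_line (ν := transport g (ofConstants (diagonalConstants K))) h hq
    fun s hs => ?_
  rw [← transport_add_smul, ← ofConstants_add_smul]
  refine mem_orbit_trans ⟨g, rfl⟩ (mem_orbit_trans ?_ (diagonal_mem_orbit_k8 h3))
  exact (hc.add_smul isAntitriangular_diagonalConstants s).mem_orbit (hqs s ▸ hs)

theorem mem_zariskiClosure_orbit_k8 [Infinite K] (h3 : (3 : K) ≠ 0) :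
    μ ∈ zariskiClosure (orbit (k8 K)) ↔ μ ∈ twoNilp K 8 ∧ finrank K (derived μ) ≤ 2 := by
  refine ⟨fun h => ⟨h.1, finrank_derived_le_of_mem_zariskiClosure ?_ h⟩, fun ⟨h, hd⟩ => ?_⟩
  · rintro _ ⟨g, rfl⟩
    exact (finrank_derived_transport_le g _).trans (finrank_derived_k8_le K)
  · let φ := algebraMap K (AlgebraicClosure K)
    refine mem_zariskiClosure_orbit_of_extend φ h ?_
    rw [extend_k8]
    refine mem_zariskiClosure_orbit_k8_of_isAlgClosed ?_ (extend_mem_twoNilp φ h)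
      ((finrank_derived_extend_le φ μ).trans hd)
    rw [← map_ofNat φ 3]
    exact (map_ne_zero φ).2 h3

end Density

section Contraction

variable {R S : Type*} [CommRing R] [CommRing S] {𝕜 : Type*} [RCLike 𝕜] {n : ℕ}
  {μ ν κ : Bracket 𝕜 n}

theorem map_equiv (φ : R →+* S) {c d : Fin n × Fin n × Fin n → R} {g : GL (Fin n) R}
    (h : ∀ x y, ofConstants c (g.val *ᵥ x) (g.val *ᵥ y) = g.val *ᵥ ofConstants d x y)
    (x y : Fin n → S) :
    ofConstants (φ ∘ c) (g.val.map φ *ᵥ x) (g.val.map φ *ᵥ y) =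
      g.val.map φ *ᵥ ofConstants (φ ∘ d) x y :=
  map_apply_of_single (fun i j => by
    simp only [← map_comp_single φ, ← map_comp_mulVec, ← map_ofConstants, h]) x y

theorem eventually_eval_ofReal_ne_zero {q : Polynomial 𝕜} (hq : q ≠ 0) :
    ∀ᶠ t : ℝ in 𝓝[>] 0, q.eval (t : 𝕜) ≠ 0 := by
  refine (nhdsGT_le_nhdsNE 0).trans (nhdsNE_le_cofinite 0) (eventually_cofinite.2 ?_)
  refine ((q.rootSet_finite 𝕜).preimage RCLike.ofReal_injective.injOn).subset fun t ht => ?_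
  simpa [Polynomial.mem_rootSet, hq] using ht

theorem exists_scale {P : ℝ → Prop} (h : ∀ᶠ t in 𝓝[>] (0 : ℝ), P t) :
    ∃ δ > 0, ∀ t ∈ Set.Ioc (0 : ℝ) 1, P (δ * t) := by
  obtain ⟨δ, hδ : 0 < δ, h⟩ := mem_nhdsGT_iff_exists_Ioc_subset.1 h
  exact ⟨δ, hδ, fun t ht => h ⟨mul_pos hδ ht.1, mul_le_of_le_one_right hδ.le ht.2⟩⟩

/-- Evaluation of continuous functions on `]0, 1]` at a point. -/
def evalAt (ε : Set.Ioc (0 : ℝ) 1) : C(Set.Ioc (0 : ℝ) 1, 𝕜) →+* 𝕜 :=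
  (ContinuousMap.evalAlgHom 𝕜 𝕜 ε).toRingHom

theorem isContraction_of_family (G : GL (Fin n) C(Set.Ioc (0 : ℝ) 1, 𝕜))
    (h : ∀ x y, Tendsto (fun ε => transport (G.map (evalAt ε)) ν x y)
      (comap Subtype.val (𝓝[>] 0)) (𝓝 (μ x y))) : IsContraction μ ν := by
  classical
  let g : Set.Ioc (0 : ℝ) 1 → GL (Fin n) 𝕜 := fun ε => G.map (evalAt ε)
  have hg : Continuous g :=
    Units.continuous_iff.2 ⟨continuous_matrix fun i j => (G.val i j).continuous,
      continuous_matrix fun i j => (G⁻¹.val i j).continuous⟩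
  let f : ℝ → GL (Fin n) 𝕜 := fun ε => if hε : ε ∈ Set.Ioc (0 : ℝ) 1 then g ⟨ε, hε⟩ else 1
  have hfg : f ∘ Subtype.val = g := funext fun ε => dif_pos ε.2
  have hf : Continuous (f ∘ (Subtype.val : Set.Ioc (0 : ℝ) 1 → ℝ)) := hfg ▸ hg
  refine ⟨f, continuousOn_iff_continuous_domRestrict.2 hf, fun x y => ?_⟩
  have hmap : map Subtype.val (comap (Subtype.val : Set.Ioc (0 : ℝ) 1 → ℝ) (𝓝[>] 0)) = 𝓝[>] 0 :=
    map_comap_of_mem (by rw [Subtype.range_coe]; exact Ioc_mem_nhdsGT one_pos)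
  rw [← hmap, tendsto_map'_iff]
  exact (h x y).congr fun ε => congrArg (transport · ν x y) (congrFun hfg ε).symm

theorem IsContraction.of_orbit (h : IsContraction μ ν) (hν : ν ∈ orbit κ) :
    IsContraction μ κ := by
  obtain ⟨g, rfl⟩ := hν
  obtain ⟨f, hf, hlim⟩ := h
  exact ⟨fun ε => f ε * g, hf.mul continuousOn_const, fun x y => by
    simpa only [transport_mul] using hlim x y⟩

theorem IsContraction.transport_left (h : IsContraction μ ν) (g : GL (Fin n) 𝕜) :
    IsContraction (transport g μ) ν := by
  obtain ⟨f, hf, hlim⟩ := h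
  refine ⟨fun ε => g * f ε, continuousOn_const.mul hf, fun x y => ?_⟩
  simp only [transport_mul, transport_apply g]
  exact ((Matrix.toLin' g.val).continuous_of_finiteDimensional.tendsto _).comp (hlim _ _)

theorem IsAntitriangular.isContraction {c : Fin 8 × Fin 8 × Fin 8 → 𝕜}
    (hc : IsAntitriangular c) :
    IsContraction (ofConstants c) (ofConstants (diagonalConstants 𝕜)) := by
  obtain ⟨q, hq, hqc⟩ := exists_eval_eq_discriminant c
  obtain ⟨δ, -, hδ⟩ := exists_scale (eventually_eval_ofReal_ne_zero hq)
  let s : C(Set.Ioc (0 : ℝ) 1, 𝕜) := ⟨fun ε => ((δ * ε : ℝ) : 𝕜), by fun_prop⟩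
  let C := algebraMap 𝕜 C(Set.Ioc (0 : ℝ) 1, 𝕜) ∘ c + s • diagonalConstants _
  have hC : ∀ ε, evalAt ε ∘ C = c + ((δ * ε : ℝ) : 𝕜) • diagonalConstants 𝕜 := fun ε => by
    rw [← map_comp_diagonalConstants (evalAt ε)]
    rfl
  have hunit : IsUnit (discriminant C) := ContinuousMap.isUnit_iff_forall_ne_zero _ |>.2 fun ε => by
    change evalAt ε (discriminant C) ≠ 0
    rw [map_discriminant, hC, ← hqc]
    exact hδ ε ε.2
  obtain ⟨g, hg⟩ := ((hc.map _).add_smul isAntitriangular_diagonalConstants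
    s).exists_equiv_diagonal hunit
  refine isContraction_of_family g fun x y => ?_
  have htransport : ∀ ε : Set.Ioc (0 : ℝ) 1,
      ofConstants c x y + ((δ * ε : ℝ) : 𝕜) • ofConstants (diagonalConstants 𝕜) x y =
        transport (g.map (evalAt ε)) (ofConstants (diagonalConstants 𝕜)) x y := fun ε => by
    rw [← map_comp_diagonalConstants (evalAt ε),
      ← (eq_transport_iff (g := g.map (evalAt ε))).2 (map_equiv (evalAt ε) hg), hC,
      ofConstants_add_smul, map_comp_diagonalConstants]
    rfl
  have hlim : Continuous fun ε : ℝ =>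
      ofConstants c x y + ((δ * ε : ℝ) : 𝕜) • ofConstants (diagonalConstants 𝕜) x y := by
    fun_prop
  have := (hlim.tendsto 0).mono_left (nhdsWithin_le_nhds (s := Set.Ioi 0))
  simp only [mul_zero, map_zero, zero_smul, add_zero] at this
  exact (this.comp tendsto_comap).congr htransport

theorem isContraction_k8 [IsAlgClosed 𝕜] {μ : Bracket 𝕜 8} (h : μ ∈ twoNilp 𝕜 8)
    (hd : Module.finrank 𝕜 (derived μ) ≤ 2) : IsContraction μ (k8 𝕜) := by
  obtain ⟨g, c, hc, rfl⟩ := exists_isAntitriangular h hd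
  exact (hc.isContraction.of_orbit (diagonal_mem_orbit_k8 three_ne_zero)).transport_left g

end Contraction

section AdaptedBasis

open Module

theorem linearIndependent_sumElim_of_ker {R V W ι κ : Type*} [Ring R] [AddCommGroup V] [Module R V]
    [AddCommGroup W] [Module R W] {T : V →ₗ[R] W} {f : ι → LinearMap.ker T} {w : κ → V}
    (hf : LinearIndependent R f) (hw : LinearIndependent R (T ∘ w)) :
    LinearIndependent R (Sum.elim (fun i => (f i : V)) w) :=
  hf.sumElim_of_quotient w (.of_comp ((LinearMap.ker T).liftQ T le_rfl) hw)

variable {𝕜 : Type*} [Field 𝕜]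

theorem exists_linearIndependent_sumElim {V ι : Type*} [AddCommGroup V] [Module 𝕜 V]
    [Fintype ι] [FiniteDimensional 𝕜 V] {v : ι → V} (hv : LinearIndependent 𝕜 v) {k : ℕ}
    (hk : Fintype.card ι + k ≤ finrank 𝕜 V) :
    ∃ w : Fin k → V, LinearIndependent 𝕜 (Sum.elim v w) := by
  have hquot : k ≤ finrank 𝕜 (V ⧸ Submodule.span 𝕜 (Set.range v)) := by
    have := (Submodule.span 𝕜 (Set.range v)).finrank_quotient_add_finrank
    rw [finrank_span_eq_card hv] at this
    omega
  obtain ⟨q, hq⟩ := exists_linearIndependent_of_le_finrank hquot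
  choose w hw using fun i => Submodule.mkQ_surjective _ (q i)
  obtain rfl : Submodule.mkQ _ ∘ w = q := funext hw
  exact ⟨w, (linearIndependent_span hv).sumElim_of_quotient w hq⟩

theorem derived_eq_span_range {n : ℕ} {μ : Bracket 𝕜 n} {v : Fin 2 → Fin n → 𝕜}
    (hd : finrank 𝕜 (derived μ) ≤ 2) (hv : LinearIndependent 𝕜 v) (hmem : ∀ i, v i ∈ derived μ) :
    derived μ = Submodule.span 𝕜 (Set.range v) := by
  refine (Submodule.eq_of_le_of_finrank_le (Submodule.span_le.2 ?_) ?_).symm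
  · rintro _ ⟨i, rfl⟩
    exact hmem i
  · rwa [finrank_span_eq_card hv, Fintype.card_fin]

theorem range_le_derived {n : ℕ} (μ : Bracket 𝕜 n) (x : Fin n → 𝕜) :
    LinearMap.range (μ x) ≤ derived μ := by
  rintro _ ⟨y, rfl⟩
  exact apply_mem_derived μ x y

theorem apply_apply_self {n : ℕ} {μ : Bracket 𝕜 n} (h : μ ∈ twoNilp 𝕜 n) (x y : Fin n → 𝕜) :
    μ x (μ x y) = 0 := by
  rw [← (mem_twoNilp.1 h).1.neg, h.2, neg_zero]

theorem notMem_derived {n : ℕ} {μ : Bracket 𝕜 n} (h : μ ∈ twoNilp 𝕜 n) {x y : Fin n → 𝕜}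
    (hxy : μ x y ≠ 0) : x ∉ derived μ := fun hx =>
  hxy (LinearMap.congr_fun (LinearMap.mem_ker.1 (derived_le_ker h hx)) y)

theorem linearIndependent_vecCons_ad {n k : ℕ} {μ : Bracket 𝕜 n} (h : μ ∈ twoNilp 𝕜 n)
    {x : Fin n → 𝕜} {w : Fin (k + 1) → Fin n → 𝕜} (hw : LinearIndependent 𝕜 (μ x ∘ w)) :
    LinearIndependent 𝕜 (Matrix.vecCons x (μ x ∘ w)) := by
  refine hw.finCons fun hx => notMem_derived h (hw.ne_zero 0) ?_
  refine Submodule.span_le.2 ?_ hx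
  rintro _ ⟨i, rfl⟩
  exact apply_mem_derived μ x (w i)

/-- The basis `b` is adapted to `μ` if `ad (b 0)` has the same matrix in the basis `b` as
`ad X₁` for `g_{2,4}` in the standard basis. -/
def IsAdapted (μ : Bracket 𝕜 8) (b : Basis (Fin 8) 𝕜 (Fin 8 → 𝕜)) : Prop :=
  ∀ j, μ (b 0) (b j) = if j = 1 then b 2 else if j = 3 then b 4 else 0

theorem exists_isAdapted {μ : Bracket 𝕜 8} (h : μ ∈ twoNilp 𝕜 8)
    (hd : finrank 𝕜 (derived μ) ≤ 2) {x : Fin 8 → 𝕜} {w : Fin 2 → Fin 8 → 𝕜}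
    (hw : LinearIndependent 𝕜 (μ x ∘ w)) : ∃ b, b 0 = x ∧ IsAdapted μ b := by
  have hker : 6 ≤ finrank 𝕜 (LinearMap.ker (μ x)) := by
    have hsum := (μ x).finrank_range_add_finrank_ker
    have hrange := (Submodule.finrank_mono (range_le_derived μ x)).trans hd
    rw [finrank_fin_fun] at hsum
    omega
  let v : Fin 3 → LinearMap.ker (μ x) := Matrix.vecCons ⟨x, (mem_twoNilp.1 h).1 x⟩
    fun i => ⟨μ x (w i), apply_apply_self h x (w i)⟩
  have hv : LinearIndependent 𝕜 v := by
    refine .of_comp (LinearMap.ker (μ x)).subtype ?_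
    convert linearIndependent_vecCons_ad h hw using 1
    ext i : 1
    cases i using Fin.cases <;> rfl
  obtain ⟨k, hk⟩ := exists_linearIndependent_sumElim hv (k := 3) (by simpa using hker)
  let e : Fin 8 → (Fin 3 ⊕ Fin 3) ⊕ Fin 2 := ![.inl (.inl 0), .inr 0, .inl (.inl 1), .inr 1,
    .inl (.inl 2), .inl (.inr 0), .inl (.inr 1), .inl (.inr 2)]
  have hb := (linearIndependent_sumElim_of_ker hk hw).comp e (by decide)
  refine ⟨basisOfLinearIndependentOfCardEqFinrank hb (by simp), ?_, fun j => ?_⟩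
  · simp [e, v]
  · fin_cases j <;> simp [e, v, apply_apply_self h, h.1.1 x]

end AdaptedBasis

section Component

open Module

variable {𝕜 : Type*} [Field 𝕜] {μ ν : Bracket 𝕜 8}

theorem g24_single_zero (y : Fin 8 → 𝕜) :
    g24 𝕜 (Pi.single 0 1) y = y 1 • Pi.single 2 1 + y 3 • Pi.single 4 1 := by
  simp [g24]

theorem g24_isAlt : (g24 𝕜).IsAlt := fun x => by
  simp [g24, mul_comm]

theorem g24_apply_mem_span (x y : Fin 8 → 𝕜) :
    g24 𝕜 x y ∈ Submodule.span 𝕜 {(Pi.single 2 1 : Fin 8 → 𝕜), Pi.single 4 1} :=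
  Submodule.mem_span_pair.2 ⟨_, _, rfl⟩

variable (𝕜) in
theorem linearIndependent_single_two_four :
    LinearIndependent 𝕜 ![(Pi.single 2 1 : Fin 8 → 𝕜), Pi.single 4 1] := by
  refine LinearIndependent.pair_iff.2 fun s t hst => ?_
  exact ⟨by simpa using congrFun hst 2, by simpa using congrFun hst 4⟩

theorem sub_g24_mem_cocyclesC1 (h : ν ∈ twoNilp 𝕜 8) (hd : finrank 𝕜 (derived ν) ≤ 2)
    (h0 : ν (Pi.single 0 1) = g24 𝕜 (Pi.single 0 1)) : ν - g24 𝕜 ∈ cocyclesC1 𝕜 := by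
  have h2 : ν (Pi.single 0 1) (Pi.single 1 1) = Pi.single 2 1 := by
    simp [h0, g24_single_zero]
  have h4 : ν (Pi.single 0 1) (Pi.single 3 1) = Pi.single 4 1 := by
    simp [h0, g24_single_zero]
  have hspan : derived ν = Submodule.span 𝕜 {(Pi.single 2 1 : Fin 8 → 𝕜), Pi.single 4 1} := by
    rw [derived_eq_span_range hd (linearIndependent_single_two_four 𝕜) ?_]
    · simp [Matrix.range_cons, Set.pair_comm]
    · rw [Fin.forall_fin_two]
      exact ⟨h2 ▸ apply_mem_derived ν _ _, h4 ▸ apply_mem_derived ν _ _⟩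
  refine ⟨fun x => ?_, fun y => ⟨?_, ?_, ?_⟩, fun x y => ?_⟩
  · simp [h.1.1 x, g24_isAlt x]
  · simp [h0]
  · have hν2 : ν (Pi.single 2 1) y = 0 := h2 ▸ h.2 _ _ _
    simp [hν2, g24]
  · have hν4 : ν (Pi.single 4 1) y = 0 := h4 ▸ h.2 _ _ _
    simp [hν4, g24]
  · exact sub_mem (hspan ▸ apply_mem_derived ν x y) (g24_apply_mem_span x y)

theorem IsAdapted.mem_C1 {b : Basis (Fin 8) 𝕜 (Fin 8 → 𝕜)} (hb : IsAdapted μ b)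
    (h : μ ∈ twoNilp 𝕜 8) (hd : finrank 𝕜 (derived μ) ≤ 2) : μ ∈ C1 𝕜 := by
  obtain ⟨g, hg⟩ := exists_GL_of_span_eq_top b.span_eq
  have hg' : ∀ i, g⁻¹.val *ᵥ b i = Pi.single i 1 := fun i => by rw [← hg, GL_inv_mulVec_mulVec]
  refine ⟨transport g⁻¹ μ - g24 𝕜, sub_g24_mem_cocyclesC1 (transport_mem_twoNilp _ h)
    ((finrank_derived_transport_le _ μ).trans hd) ?_, g, ?_⟩
  · refine (Pi.basisFun 𝕜 (Fin 8)).ext fun j => ?_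
    rw [Pi.basisFun_apply, transport_apply, inv_inv, hg, hg, hb, g24_single_zero]
    by_cases h1 : j = 1
    · simpa [h1] using hg' 2
    by_cases h3 : j = 3
    · simpa [h3] using hg' 4
    simp [h1, h3, Ne.symm h1, Ne.symm h3]
  · rw [add_sub_cancel (g24 𝕜) (transport g⁻¹ μ), ← transport_mul, mul_inv_cancel, transport_one]

theorem exists_linearIndependent_transport {n k : ℕ} {μ : Bracket 𝕜 n} (g : GL (Fin n) 𝕜)
    {x : Fin n → 𝕜} {w : Fin k → Fin n → 𝕜} (hw : LinearIndependent 𝕜 (μ x ∘ w)) :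
    LinearIndependent 𝕜 (transport g μ (g.val *ᵥ x) ∘ fun i => g.val *ᵥ w i) := by
  have hcomp : transport g μ (g.val *ᵥ x) ∘ (fun i => g.val *ᵥ w i) =
      g.val.mulVec ∘ (μ x ∘ w) :=
    funext fun i => eq_transport_iff.1 rfl x (w i)
  rw [hcomp]
  exact hw.map' (Matrix.toLin' g.val)
    (LinearMap.ker_eq_bot.2 (Function.LeftInverse.injective (GL_inv_mulVec_mulVec g)))

theorem g24_add_mem_twoNilp {φ : Bracket 𝕜 8} (hφ : φ ∈ cocyclesC1 𝕜) :
    g24 𝕜 + φ ∈ twoNilp 𝕜 8 := by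
  obtain ⟨halt, hzero, hspan⟩ := hφ
  refine mem_twoNilp.2 ⟨fun x => by simp [g24_isAlt x, halt x], fun x y z => ?_⟩
  obtain ⟨s, t, hst⟩ := Submodule.mem_span_pair.1 (add_mem (g24_apply_mem_span x y) (hspan x y))
  have hxy : (g24 𝕜 + φ) x y = s • Pi.single 2 1 + t • Pi.single 4 1 := hst.symm
  rw [hxy]
  simp [g24, (hzero z).2.1, (hzero z).2.2]

theorem mem_C1_iff : μ ∈ C1 𝕜 ↔ μ ∈ twoNilp 𝕜 8 ∧ finrank 𝕜 (derived μ) ≤ 2 ∧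
    ∃ x, ∃ w : Fin 2 → Fin 8 → 𝕜, LinearIndependent 𝕜 (μ x ∘ w) := by
  constructor
  · rintro ⟨φ, hφ, g, rfl⟩
    have hd : finrank 𝕜 (derived (g24 𝕜 + φ)) ≤ 2 :=
      finrank_derived_le_two fun x y => add_mem (g24_apply_mem_span x y) (hφ.2.2 x y)
    refine ⟨transport_mem_twoNilp g (g24_add_mem_twoNilp hφ),
      (finrank_derived_transport_le g _).trans hd, _, _, exists_linearIndependent_transport
        (x := Pi.single 0 1) (w := ![Pi.single 1 1, Pi.single 3 1]) g ?_⟩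
    convert linearIndependent_single_two_four 𝕜 using 1
    ext i : 1
    fin_cases i <;> simp [g24_single_zero, (hφ.2.1 _).1]
  · rintro ⟨h, hd, x, w, hw⟩
    obtain ⟨b, -, hb⟩ := exists_isAdapted h hd hw
    exact hb.mem_C1 h hd

theorem orbit_k8_subset_C1 : orbit (k8 𝕜) ⊆ C1 𝕜 := by
  rintro _ ⟨g, rfl⟩
  refine mem_C1_iff.2 ⟨transport_mem_twoNilp g k8_mem_twoNilp,
    (finrank_derived_transport_le g _).trans (finrank_derived_k8_le 𝕜), _, _,
      exists_linearIndependent_transport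
        (x := -Pi.single 0 1) (w := ![Pi.single 1 1, Pi.single 3 1]) g ?_⟩
  convert linearIndependent_single_two_four 𝕜 using 1
  ext i : 1
  fin_cases i <;> simp [k8]

end Component

section CharacteristicSequence

open Module

variable {𝕜 V : Type*} [Field 𝕜] [AddCommGroup V] [Module 𝕜 V] {T : V →ₗ[𝕜] V} {l : List ℕ}

theorem IsNilpotentJordanType.le_of_pow_eq_zero (h : IsNilpotentJordanType T l) {m : ℕ}
    (hT : T ^ m = 0) : ∀ k ∈ l, k ≤ m := by
  obtain ⟨-, -, b, hb⟩ := h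
  intro k hk
  obtain ⟨i, rfl⟩ := List.get_of_mem hk
  by_contra! hm
  have hpow : ∀ j (hj : j < l.get i), (T ^ j) (b ⟨i, ⟨j, hj⟩⟩) = b ⟨i, ⟨0, by omega⟩⟩ := by
    intro j
    induction j with
    | zero => exact fun _ => rfl
    | succ j ih =>
      intro hj
      rw [pow_succ, Module.End.mul_apply, (hb i ⟨j, by omega⟩).2 ⟨j + 1, hj⟩ rfl, ih]
  exact b.ne_zero _ (by rw [← hpow m hm, hT, LinearMap.zero_apply])

theorem IsNilpotentJordanType.sum_eq_finrank (h : IsNilpotentJordanType T l) :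
    l.sum = finrank 𝕜 V := by
  obtain ⟨-, -, b, -⟩ := h
  rw [finrank_eq_card_basis b, Fintype.card_sigma, ← List.sum_ofFn]
  simp

/- The top vectors of the first `m + 1` blocks have independent images. -/
theorem IsNilpotentJordanType.exists_linearIndependent_comp (h : IsNilpotentJordanType T l)
    {m : ℕ} (hm : m < l.length) (hlm : 1 < l[m]) :
    ∃ w : Fin (m + 1) → V, LinearIndependent 𝕜 (T ∘ w) := by
  obtain ⟨hsort, -, b, hb⟩ := h
  have hlt (i : Fin (m + 1)) : 1 < l.get (i.castLE hm) :=
    hlm.trans_le (hsort.rel_get_of_le (a := i.castLE hm) (b := ⟨m, hm⟩) (Nat.le_of_lt_succ i.2))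
  refine ⟨fun i => b ⟨i.castLE hm, ⟨1, hlt i⟩⟩, ?_⟩
  have hT : T ∘ (fun i => b ⟨i.castLE hm, ⟨1, hlt i⟩⟩) =
      b ∘ fun i => ⟨i.castLE hm, ⟨0, by have := hlt i; omega⟩⟩ :=
    funext fun i => (hb _ _).2 _ rfl
  rw [hT]
  exact b.linearIndependent.comp _ fun i j hij =>
    Fin.castLE_injective hm (congrArg Sigma.fst hij)

theorem le_of_sum_eq_eight (hsort : l.Pairwise (· ≥ ·)) (hpos : ∀ k ∈ l, 0 < k)
    (hle : ∀ k ∈ l, k ≤ 2) (hsum : l.sum = 8) (h2 : ∀ h : 2 < l.length, l[2] ≤ 1) :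
    l ≤ [2, 2, 1, 1, 1, 1] := by
  rw [← not_lt]
  rcases l with _ | ⟨a, _ | ⟨b, _ | ⟨c, _ | ⟨d, _ | ⟨e, _ | ⟨f, _ | ⟨g, l⟩⟩⟩⟩⟩⟩⟩ <;>
    simp [List.cons_lt_cons_iff] at hsort hpos hle hsum h2 ⊢ <;> omega

theorem IsNilpotentJordanType.le (h : IsNilpotentJordanType T l) (hV : finrank 𝕜 V = 8)
    (hT : T ^ 2 = 0) (hr : finrank 𝕜 (LinearMap.range T) ≤ 2) : l ≤ [2, 2, 1, 1, 1, 1] := by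
  have : FiniteDimensional 𝕜 V := .of_finrank_pos (by omega)
  refine le_of_sum_eq_eight h.1 h.2.1 (h.le_of_pow_eq_zero hT) (h.sum_eq_finrank.trans hV)
    fun hlen => ?_
  by_contra! hl2
  obtain ⟨w, hw⟩ := h.exists_linearIndependent_comp hlen hl2
  have hcard := (LinearIndependent.of_comp (v := T.rangeRestrict ∘ w)
    (LinearMap.range T).subtype hw).fintype_card_le_finrank
  rw [Fintype.card_fin] at hcard
  omega

/-- The position, in an adapted basis, of the Jordan basis vector with index `(i, j)`. -/
def jordanIndex (s : Σ i : Fin [2, 2, 1, 1, 1, 1].length, Fin ([2, 2, 1, 1, 1, 1].get i)) :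
    Fin 8 :=
  ![![2, 1], ![4, 3], ![0, 0], ![5, 5], ![6, 6], ![7, 7]] s.1 (s.2.castLE (by decide +revert))

theorem jordanIndex_bijective : Function.Bijective jordanIndex := by
  decide

theorem IsAdapted.isNilpotentJordanType {μ : Bracket 𝕜 8} {b : Basis (Fin 8) 𝕜 (Fin 8 → 𝕜)}
    (hb : IsAdapted μ b) : IsNilpotentJordanType (μ (b 0)) [2, 2, 1, 1, 1, 1] := by
  refine ⟨by decide, by decide, b.reindex (Equiv.ofBijective _ jordanIndex_bijective).symm,
    fun i j => ⟨fun hj => ?_, fun j' hj' => ?_⟩⟩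
  · have hker : ∀ i j, j.val = 0 → jordanIndex ⟨i, j⟩ ≠ 1 ∧ jordanIndex ⟨i, j⟩ ≠ 3 := by decide
    simp [hb _, hker i j hj]
  · have hshift : ∀ i, ∀ j j' : Fin ([2, 2, 1, 1, 1, 1].get i), j'.val = j.val + 1 →
        (jordanIndex ⟨i, j'⟩ = 1 ∧ jordanIndex ⟨i, j⟩ = 2) ∨
          (jordanIndex ⟨i, j'⟩ = 3 ∧ jordanIndex ⟨i, j⟩ = 4) := by decide
    obtain h | h := hshift i j j' hj' <;> simp [hb _, h]

theorem mem_C1_iff_mem_F24 {μ : Bracket 𝕜 8} :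
    μ ∈ C1 𝕜 ↔ μ ∈ F24 𝕜 ∧ finrank 𝕜 (derived μ) ≤ 2 := by
  rw [mem_C1_iff]
  constructor
  · rintro ⟨h, hd, x, w, hw⟩
    obtain ⟨b, rfl, hb⟩ := exists_isAdapted h hd hw
    refine ⟨⟨h, ⟨b 0, notMem_derived h (hw.ne_zero 0), hb.isNilpotentJordanType⟩,
      fun X _ l hl => hl.le (finrank_fin_fun 𝕜) ?_ ?_⟩, hd⟩
    · exact LinearMap.ext fun y => by simpa [pow_two] using apply_apply_self h X y
    · exact (Submodule.finrank_mono (range_le_derived μ X)).trans hd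
  · rintro ⟨⟨h, ⟨x, -, hx⟩, -⟩, hd⟩
    exact ⟨h, hd, x, hx.exists_linearIndependent_comp (m := 1) (by simp) (by simp)⟩

theorem zariskiClosure_C1 [Infinite 𝕜] (h3 : (3 : 𝕜) ≠ 0) :
    zariskiClosure (C1 𝕜) = zariskiClosure (orbit (k8 𝕜)) := by
  refine (zariskiClosure_subset_of_subset fun μ hμ => ?_).antisymm
    (zariskiClosure_subset_of_subset
      (orbit_k8_subset_C1.trans (subset_zariskiClosure fun μ hμ => ?_)))
  · obtain ⟨h, hd, -⟩ := mem_C1_iff.1 hμ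
    exact (mem_zariskiClosure_orbit_k8 h3).2 ⟨h, hd⟩
  · exact (mem_C1_iff.1 hμ).1

end CharacteristicSequence

end TwoNilp

end

theorem mainTheorem8_general :
    (∀ (𝕜 : Type*) [Field 𝕜] [Infinite 𝕜], (3 : 𝕜) ≠ 0 →
      TwoNilp.C1 𝕜 = TwoNilp.F24 𝕜 ∩ TwoNilp.zariskiClosure (TwoNilp.orbit (TwoNilp.k8 𝕜)) ∧
      TwoNilp.zariskiClosure (TwoNilp.C1 𝕜) =
        TwoNilp.zariskiClosure (TwoNilp.orbit (TwoNilp.k8 𝕜))) ∧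
    ∀ μ ∈ TwoNilp.zariskiClosure (TwoNilp.C1 ℂ), TwoNilp.IsContraction μ (TwoNilp.k8 ℂ) := by
  refine ⟨fun 𝕜 _ _ h3 => ⟨?_, TwoNilp.zariskiClosure_C1 h3⟩, fun μ hμ => ?_⟩
  · ext μ
    rw [TwoNilp.mem_C1_iff_mem_F24, Set.mem_inter_iff, TwoNilp.mem_zariskiClosure_orbit_k8 h3]
    exact ⟨fun h => ⟨h.1, h.1.1, h.2⟩, fun h => ⟨h.1, h.2.2⟩⟩
  · rw [TwoNilp.zariskiClosure_C1 three_ne_zero] at hμ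
    obtain ⟨h, hd⟩ := (TwoNilp.mem_zariskiClosure_orbit_k8 three_ne_zero).1 hμ
    exact TwoNilp.isContraction_k8 h hd

theorem mainTheorem8 :
    (∀ (𝕜 : Type) [RCLike 𝕜],
      TwoNilp.C1 𝕜 = TwoNilp.F24 𝕜 ∩ TwoNilp.zariskiClosure (TwoNilp.orbit (TwoNilp.k8 𝕜)) ∧
      TwoNilp.zariskiClosure (TwoNilp.C1 𝕜) =
        TwoNilp.zariskiClosure (TwoNilp.orbit (TwoNilp.k8 𝕜))) ∧
    (∀ μ ∈ TwoNilp.zariskiClosure (TwoNilp.C1 ℂ), μ ∉ TwoNilp.orbit (TwoNilp.k8 ℂ) →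
      TwoNilp.IsContraction μ (TwoNilp.k8 ℂ)) :=
  ⟨fun _ _ => mainTheorem8_general.1 _ three_ne_zero,
    fun μ hμ _ => mainTheorem8_general.{0}.2 μ hμ⟩
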